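/- Let $M$ be a compact smooth $n$-manifold without boundary with a spin structure, i.e. a smooth principal $\mathrm{Spin}(n)$-bundle $PSpin(M)\to M$ whose associated $SO(n)$-bundle is identified with a smooth reduction of the frame bundle of $M$. Let $V\neq 0$ be a finite dimensional complex inner product space with self-adjoint Clifford matrices $\gamma^1,\dots,\gamma^n$, $\gamma^i\gamma^j+\gamma^j\gamma^i=2\delta^{ij}$ (for instance the spinor module), and let $SM=PSpin(M)\times_{\mathrm{Spin}(n)}V$. Let $\mathcal D^{1/4}$ be the bundle of quarter densities $f\,(dx^1\cdots dx^n)^{1/4}$. Let $g$ be a possibly singular Riemannian metric on $M$ of finite volume, given by a $\mathrm{Spin}(n)$-equivariant horizontal $\mathbb R^n$-valued $1$-form $\tau$ on $PSpin(M)$ which induces an isomorphism $T_xM\to\mathbb R^n$ for almost every $x\in M$. With respect to a coordinate chart and a smooth local section of $PSpin(M)$ over its domain (a local orthonormal frame), write $\tau^i=e_\mu^{\ i}dx^\mu$, let $(e_i^{\ \mu})$ be the inverse matrix of $(e_\mu^{\ i})$, and put $g_{\mu\nu}=\sum_i e_\mu^{\ i}e_\nu^{\ i}$, $|g|=\det(g_{\mu\nu})$.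 Assume that there is a closed set $\mathcal S\subset M$ of measure zero outside of which all $e_\mu^{\ i}$ are locally $L^1$ and their first partial derivatives in the sense of distributions are functions. In terms of these derivatives, let $\omega^i_{\ j}=\omega^i_{\ j\mu}dx^\mu$ be the solution of $\omega^i_{\ j}+\omega^j_{\ i}=0$, $d\tau^i+\omega^i_{\ j}\wedge\tau^j=0$ (almost everywhere), and put $\omega_{abc}=\omega^a_{\ b\mu}e_c^{\ \mu}$ and $\partial_\mu\log|g|=g^{\delta\epsilon}\partial_\mu g_{\delta\epsilon}$, the derivative of $g_{\delta\epsilon}$ being given by the product rule. The Dirac operator $\widehat D$ on $SM\otimes\mathcal D^{1/4}$ is, locally, $$\widehat D\big(\psi\otimes(dx^1\cdots dx^n)^{1/4}\big)=-\sqrt{-1}\,\gamma^i e_i^{\ \mu}\Big(\partial_\mu\psi+\tfrac18\,\omega_{jk\mu}[\gamma^j,\gamma^k]\psi-\tfrac18(\partial_\mu\log|g|)\psi\Big)\otimes(dx^1\cdots dx^n)^{1/4},$$ and $L^2(SM\otimes\mathcal D^{1/4},\sqrt{\operatorname{dvol}_g})$ is the space of measurable sections $\Xi$ with $\int_M\langle\Xi,\Xi\rangle\sqrt{\operatorname{dvol}_g}<\infty$,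 where the integrand is $|\psi|^2|g|^{1/4}dx^1\cdots dx^n$ for $\Xi=\psi\otimes(dx^1\cdots dx^n)^{1/4}$. Then $\widehat D$ maps $C^\infty(SM\otimes\mathcal D^{1/4})$ into $L^2(SM\otimes\mathcal D^{1/4},\sqrt{\operatorname{dvol}_g})$ if and only if, in every coordinate chart and with respect to every such local orthonormal frame over it, for all values of the free indices, the functions $$e_a^{\ \mu},\qquad \operatorname{Alt}_{abc}\,\omega_{abc},\qquad 4\,e_a^{\ \mu}\omega^a_{\ b\mu}-e_b^{\ \mu}\partial_\mu\log|g|$$ (with repeated indices summed, and $\operatorname{Alt}$ denoting antisymmetrization with factor $\tfrac1{3!}$) are $L^2$ with respect to $|g|^{1/4}dx^1\cdots dx^n$ on every compact subset of the chart. -/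

import Mathlib

open scoped Manifold ContDiff Topology ENNReal
open MeasureTheory

noncomputable section

namespace QuarterDensityDirac

/-! ### Clifford algebra, spin group, Clifford matrices -/

/-- Euclidean `n`-space. -/
abbrev Euc (n : ℕ) : Type := EuclideanSpace ℝ (Fin n)

/-- The quadratic form `v ↦ |v|²` on Euclidean `n`-space. -/
def euclideanForm (n : ℕ) : QuadraticForm ℝ (Euc n) :=
  LinearMap.BilinMap.toQuadraticMap (innerₗ (Euc n))

lemma euclideanForm_apply {n : ℕ} (v : Euc n) : euclideanForm n v = ∑ i, v i * v i := by
  rw [euclideanForm, LinearMap.BilinMap.toQuadraticMap_apply, innerₗ_apply_apply,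
    PiLp.inner_apply]
  simp [pow_two]

/-- The Clifford algebra with `v * v = |v|²`. -/
abbrev Cliff (n : ℕ) : Type := CliffordAlgebra (euclideanForm n)

/-- The group `Spin(n)`, inside the Clifford algebra. -/
abbrev Spin (n : ℕ) : Type := spinGroup (euclideanForm n)

/-- The inclusion of Euclidean `n`-space into the Clifford algebra. -/
abbrev vec {n : ℕ} : Euc n →ₗ[ℝ] Cliff n := CliffordAlgebra.ι (euclideanForm n)

/-- Clifford matrices on a complex inner product space `V`: self-adjoint operators with
`γ^i γ^j + γ^j γ^i = 2 δ^{ij}`. -/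
structure CliffordMatrices (n : ℕ) (V : Type*) [NormedAddCommGroup V] [InnerProductSpace ℂ V]
    [FiniteDimensional ℂ V] where
  mat : Fin n → V →L[ℂ] V
  selfAdjoint : ∀ i (v w : V), inner ℂ (mat i v) w = inner ℂ v (mat i w)
  anticomm : ∀ i j, mat i * mat j + mat j * mat i = if i = j then 2 else 0

section Rep

variable {n : ℕ} {V : Type*} [NormedAddCommGroup V] [InnerProductSpace ℂ V]
  [FiniteDimensional ℂ V]

/-- Clifford multiplication by a vector, `v ↦ ∑ v_i γ^i`. -/
def CliffordMatrices.mulVec (γ : CliffordMatrices n V) : Euc n →ₗ[ℝ] (V →L[ℂ] V) where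
  toFun v := ∑ i, v i • γ.mat i
  map_add' v w := by simp [add_smul, Finset.sum_add_distrib]
  map_smul' c v := by simp [mul_smul, Finset.smul_sum]

lemma CliffordMatrices.mulVec_sq (γ : CliffordMatrices n V) (v : Euc n) :
    γ.mulVec v * γ.mulVec v = algebraMap ℝ (V →L[ℂ] V) (euclideanForm n v) := by
  have h1 : γ.mulVec v * γ.mulVec v = ∑ i, ∑ j, (v i * v j) • (γ.mat i * γ.mat j) := by
    simp only [CliffordMatrices.mulVec, LinearMap.coe_mk, AddHom.coe_mk, Finset.sum_mul_sum,
      smul_mul_smul_comm]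
  have h2 : γ.mulVec v * γ.mulVec v = ∑ i, ∑ j, (v i * v j) • (γ.mat j * γ.mat i) := by
    rw [h1, Finset.sum_comm]
    simp only [mul_comm]
  have h3 : (2 : ℝ) • (γ.mulVec v * γ.mulVec v)
      = (2 : ℝ) • algebraMap ℝ (V →L[ℂ] V) (euclideanForm n v) := by
    rw [two_smul]
    nth_rewrite 1 [h1]
    rw [h2, ← Finset.sum_add_distrib]
    simp only [← Finset.sum_add_distrib, ← smul_add, γ.anticomm]
    simp only [smul_ite, smul_zero, Finset.sum_ite_eq, Finset.mem_univ, if_true]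
    rw [euclideanForm_apply, Algebra.algebraMap_eq_smul_one, smul_smul, ← Finset.sum_smul,
      mul_comm, mul_smul]
    congr 1
    rw [two_smul, one_add_one_eq_two]
  exact smul_right_injective _ (two_ne_zero) h3

/-- The action of the Clifford algebra, in particular of `Spin(n)`, on spinors. -/
def CliffordMatrices.rep (γ : CliffordMatrices n V) : Cliff n →ₐ[ℝ] (V →L[ℂ] V) :=
  CliffordAlgebra.lift (euclideanForm n) ⟨γ.mulVec, γ.mulVec_sq⟩

end Rep

/-! ### Spin structures and soldering forms -/

section Manifold

variable {n : ℕ} {M : Type*} [TopologicalSpace M] [ChartedSpace (Euc n) M]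

/-- The coordinate vector field `∂_μ` of a chart `φ`, at the point with coordinates `y`. -/
def coordVector (φ : OpenPartialHomeomorph M (Euc n)) (y : Euc n) (μ : Fin n) :
    TangentSpace 𝓘(ℝ, Euc n) (φ.symm y) :=
  mfderiv 𝓘(ℝ, Euc n) 𝓘(ℝ, Euc n) φ.symm y
    (show TangentSpace 𝓘(ℝ, Euc n) y from EuclideanSpace.single μ (1 : ℝ))

/-- A `Spin(n)`-valued map is smooth on `U`: it is smooth as a map to the (finite dimensional)
Clifford algebra. -/
def SmoothSpinOn (k : M → Spin n) (U : Set M) : Prop :=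
  ∀ l : Cliff n →ₗ[ℝ] ℝ,
    ContMDiffOn 𝓘(ℝ, Euc n) 𝓘(ℝ, ℝ) ∞ (fun x => l (k x : Cliff n)) U

variable (n M) in
/-- A smooth principal `Spin(n)`-bundle over `M`: right `Spin(n)`-torsors `Fib x`, `x ∈ M`,
and a family of local sections over open sets covering `M`, with smooth transition functions.
(Only the values of a local section on its open set matter.) -/
structure SpinBundle where
  Fib : M → Type*
  act : ∀ {x}, Fib x → Spin n → Fib x
  act_one : ∀ {x} (p : Fib x), act p 1 = p
  act_mul : ∀ {x} (p : Fib x) (k l : Spin n), act p (k * l) = act (act p k) l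
  existsUnique_act : ∀ {x} (p q : Fib x), ∃! k, q = act p k
  atlas : Set (Set M × (∀ x, Fib x))
  isOpen_of_mem : ∀ f ∈ atlas, IsOpen f.1
  cover : ∀ x, ∃ f ∈ atlas, x ∈ f.1
  smooth_transition : ∀ f ∈ atlas, ∀ f' ∈ atlas, ∃ k : M → Spin n,
    SmoothSpinOn k (f.1 ∩ f'.1) ∧ ∀ x ∈ f.1 ∩ f'.1, f'.2 x = act (f.2 x) (k x)

/-- `s` is a smooth section over `U` of a principal spin bundle. -/
def SpinBundle.IsSmoothSection (B : SpinBundle n M) (U : Set M) (s : ∀ x, B.Fib x) : Prop :=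
  ∀ f ∈ B.atlas, ∃ k : M → Spin n,
    SmoothSpinOn k (U ∩ f.1) ∧ ∀ x ∈ U ∩ f.1, s x = B.act (f.2 x) (k x)

/-- A coordinate chart of `M`, together with a smooth section of the spin bundle over its
domain (that is, with a local spin frame). -/
structure SpinBundle.Gauge (B : SpinBundle n M) where
  chart : OpenPartialHomeomorph M (Euc n)
  chart_mem : chart ∈ IsManifold.maximalAtlas 𝓘(ℝ, Euc n) ∞ M
  frame : ∀ x, B.Fib x
  smooth_frame : B.IsSmoothSection chart.source frame

/-- An `ℝⁿ`-valued horizontal `1`-form on a principal spin bundle that is equivariant with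
respect to the rotation action of `Spin(n)` on `ℝⁿ`: since it is horizontal, at a point `p` over
`x` it is a linear map `T_xM → ℝⁿ`.  There is no regularity here. -/
structure SpinBundle.EquivariantForm (B : SpinBundle n M) where
  form : ∀ x, B.Fib x → TangentSpace 𝓘(ℝ, Euc n) x →ₗ[ℝ] Euc n
  equivariant : ∀ x (p : B.Fib x) (k : Spin n) (v : TangentSpace 𝓘(ℝ, Euc n) x),
    (k : Cliff n) * vec (form x (B.act p k) v) = vec (form x p v) * (k : Cliff n)

/-- The components `e_μ^i` of an equivariant form with respect to a chart and a local section
of the spin bundle, as functions of the coordinates. -/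
def SpinBundle.EquivariantForm.comp {B : SpinBundle n M} (τ : B.EquivariantForm) (G : B.Gauge)
    (μ i : Fin n) (y : Euc n) : ℝ :=
  τ.form (G.chart.symm y) (G.frame (G.chart.symm y)) (coordVector G.chart y μ) i

variable (n M) in
/-- A spin structure on `M`: a principal `Spin(n)`-bundle `PSpin(M)`, together with a smooth
soldering form `τ₀`, which presents the associated `SO(n)`-bundle as a reduction of the frame
bundle of `M`. -/
structure SpinStructure extends SpinBundle n M where
  solder : toSpinBundle.EquivariantForm
  solder_bijective : ∀ x (p : toSpinBundle.Fib x), Function.Bijective (solder.form x p)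
  solder_smooth : ∀ (G : toSpinBundle.Gauge) (μ i : Fin n),
    ContDiffOn ℝ ∞ (solder.comp G μ i) G.chart.target

/-! ### Pointwise formulas in a local orthonormal frame

Here `e μ i = e_μ^i` is an invertible matrix and `de ρ μ i = ∂_ρ e_μ^i`. The dual frame
is `e⁻¹ i μ = e_i^μ`. -/

/-- The metric tensor `g_{μν} = ∑_i e_μ^i e_ν^i`. -/
def metric (e : Matrix (Fin n) (Fin n) ℝ) : Matrix (Fin n) (Fin n) ℝ :=
  Matrix.of fun μ ν => ∑ i, e μ i * e ν i

/-- `∂_ρ log |g| = g^{μν} ∂_ρ g_{μν}`, where `g_{μν} = ∑_i e_μ^i e_ν^i`. -/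
def dLogDet (e : Matrix (Fin n) (Fin n) ℝ) (de : Fin n → Fin n → Fin n → ℝ) (ρ : Fin n) : ℝ :=
  ∑ μ, ∑ ν, (metric e)⁻¹ μ ν * ∑ i, (de ρ μ i * e ν i + e μ i * de ρ ν i)

/-- `C i k l = dτ^i(e_k, e_l)`. -/
def structureCoeff (e : Matrix (Fin n) (Fin n) ℝ) (de : Fin n → Fin n → Fin n → ℝ)
    (i k l : Fin n) : ℝ :=
  ∑ ρ, ∑ σ, e⁻¹ k ρ * e⁻¹ l σ * (de ρ σ i - de σ ρ i)

/-- The connection coefficients `ω_{ijk} = ω^i_{jμ} e_k^μ`. -/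
def connCoeff (e : Matrix (Fin n) (Fin n) ℝ) (de : Fin n → Fin n → Fin n → ℝ)
    (i j k : Fin n) : ℝ :=
  (structureCoeff e de i j k + structureCoeff e de j k i - structureCoeff e de k i j) / 2

/-- The components `ω^i_{jμ}` of the connection `1`-forms. -/
def connForm (e : Matrix (Fin n) (Fin n) ℝ) (de : Fin n → Fin n → Fin n → ℝ)
    (i j μ : Fin n) : ℝ :=
  ∑ k, connCoeff e de i j k * e μ k

/-- Metric compatibility `ω^i_j + ω^j_i = 0` and vanishing torsion `dτ^i + ω^i_j ∧ τ^j = 0`. -/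
def IsLeviCivita (e : Matrix (Fin n) (Fin n) ℝ) (de : Fin n → Fin n → Fin n → ℝ)
    (w : Fin n → Fin n → Fin n → ℝ) : Prop :=
  (∀ i j μ, w i j μ + w j i μ = 0) ∧
  ∀ i ρ σ, de ρ σ i - de σ ρ i + ∑ j, (w i j ρ * e σ j - w i j σ * e ρ j) = 0

/-- The connection `1`-forms are the unique solution of the two structure equations. -/
theorem isLeviCivita_iff {e : Matrix (Fin n) (Fin n) ℝ} (he : IsUnit e.det)
    (de : Fin n → Fin n → Fin n → ℝ) (w : Fin n → Fin n → Fin n → ℝ) :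
    IsLeviCivita e de w ↔ w = connForm e de := by
  have h1 : ∀ k l, ∑ ρ, e⁻¹ k ρ * e ρ l = if k = l then 1 else 0 := fun k l => by
    rw [← Matrix.mul_apply, Matrix.nonsing_inv_mul e he, Matrix.one_apply]
  have h2 : ∀ μ ν, ∑ k, e μ k * e⁻¹ k ν = if μ = ν then 1 else 0 := fun μ ν => by
    rw [← Matrix.mul_apply, Matrix.mul_nonsing_inv e he, Matrix.one_apply]
  have hC : ∀ i k l, structureCoeff e de i k l = -structureCoeff e de i l k := fun i k l => by
    unfold structureCoeff
    rw [Finset.sum_comm, ← Finset.sum_neg_distrib]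
    refine Finset.sum_congr rfl fun ρ _ => ?_
    rw [← Finset.sum_neg_distrib]
    exact Finset.sum_congr rfl fun σ _ => by ring
  constructor
  · rintro ⟨ha, ht⟩
    set W : Fin n → Fin n → Fin n → ℝ := fun i j k => ∑ μ, w i j μ * e⁻¹ k μ with hW
    have hWa : ∀ i j k, W i j k = -W j i k := fun i j k => by
      simp only [hW, ← Finset.sum_neg_distrib]
      exact Finset.sum_congr rfl fun μ _ => by linear_combination e⁻¹ k μ * ha i j μ
    have hWt : ∀ i k l, structureCoeff e de i k l = W i k l - W i l k := fun i k l => by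
      have hA : ∀ k l, ∑ ρ, ∑ σ, e⁻¹ k ρ * e⁻¹ l σ * ∑ j, w i j ρ * e σ j = W i l k := by
        intro k l
        calc ∑ ρ, ∑ σ, e⁻¹ k ρ * e⁻¹ l σ * ∑ j, w i j ρ * e σ j
            = ∑ ρ, ∑ j, w i j ρ * e⁻¹ k ρ * ∑ σ, e⁻¹ l σ * e σ j := by
              refine Finset.sum_congr rfl fun ρ _ => ?_
              simp only [Finset.mul_sum]
              rw [Finset.sum_comm]
              exact Finset.sum_congr rfl fun _ _ => Finset.sum_congr rfl fun _ _ => by ring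
          _ = W i l k := by simp [h1, hW]
      have hB : ∑ ρ, ∑ σ, e⁻¹ k ρ * e⁻¹ l σ * ∑ j, w i j σ * e ρ j = W i k l := by
        rw [← hA l k, Finset.sum_comm]
        exact Finset.sum_congr rfl fun _ _ => Finset.sum_congr rfl fun _ _ => by ring
      rw [← hA k l, ← hB]
      unfold structureCoeff
      rw [← Finset.sum_sub_distrib]
      refine Finset.sum_congr rfl fun ρ _ => ?_
      rw [← Finset.sum_sub_distrib]
      refine Finset.sum_congr rfl fun σ _ => ?_
      have := ht i ρ σ
      rw [Finset.sum_sub_distrib] at this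
      linear_combination e⁻¹ k ρ * e⁻¹ l σ * this
    funext i j μ
    have hWc : ∀ k, connCoeff e de i j k = W i j k := fun k => by
      unfold connCoeff
      rw [hWt, hWt, hWt, hWa j k i, hWa k i j, hWa j i k]
      ring
    simp only [connForm, hWc, hW, Finset.sum_mul]
    rw [Finset.sum_comm]
    have : ∀ ν, ∑ k, w i j ν * e⁻¹ k ν * e μ k = w i j ν * if μ = ν then 1 else 0 := fun ν => by
      rw [← h2 μ ν, Finset.mul_sum]
      exact Finset.sum_congr rfl fun _ _ => by ring
    simp [this]
  · rintro rfl
    constructor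
    · intro i j μ
      simp only [connForm, ← Finset.sum_add_distrib]
      refine Finset.sum_eq_zero fun k _ => ?_
      unfold connCoeff
      rw [hC i j k, hC i k j, hC j i k, hC k i j, hC j k i]
      rw [hC i j k]
      ring
    · intro i ρ σ
      have hD : de ρ σ i - de σ ρ i
          = ∑ k, ∑ l, structureCoeff e de i k l * (e ρ k * e σ l) := by
        have : ∀ k l, structureCoeff e de i k l * (e ρ k * e σ l) = ∑ ρ', ∑ σ',
            (e ρ k * e⁻¹ k ρ') * ((e σ l * e⁻¹ l σ') * (de ρ' σ' i - de σ' ρ' i)) := by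
          intro k l
          simp only [structureCoeff, Finset.sum_mul]
          exact Finset.sum_congr rfl fun _ _ => Finset.sum_congr rfl fun _ _ => by ring
        have h3 : ∀ k, ∑ l, structureCoeff e de i k l * (e ρ k * e σ l)
            = ∑ ρ', (e ρ k * e⁻¹ k ρ') * ∑ σ', (∑ l, e σ l * e⁻¹ l σ')
                * (de ρ' σ' i - de σ' ρ' i) := by
          intro k
          simp only [this]
          rw [Finset.sum_comm]
          refine Finset.sum_congr rfl fun ρ' _ => ?_
          rw [Finset.sum_comm, Finset.mul_sum]
          refine Finset.sum_congr rfl fun σ' _ => ?_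
          rw [Finset.sum_mul, Finset.mul_sum]
        simp only [h3]
        rw [Finset.sum_comm]
        simp only [← Finset.sum_mul, h2]
        simp
      have hS : ∑ j, (connForm e de i j ρ * e σ j - connForm e de i j σ * e ρ j)
          = ∑ k, ∑ l, (connCoeff e de i l k - connCoeff e de i k l) * (e ρ k * e σ l) := by
        simp only [connForm, Finset.sum_mul, Finset.sum_sub_distrib, sub_mul]
        congr 1
        · rw [Finset.sum_comm]
          exact Finset.sum_congr rfl fun _ _ => Finset.sum_congr rfl fun _ _ => by ring
        · exact Finset.sum_congr rfl fun _ _ => Finset.sum_congr rfl fun _ _ => by ring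
      rw [hD, hS, ← Finset.sum_add_distrib]
      refine Finset.sum_eq_zero fun k _ => ?_
      rw [← Finset.sum_add_distrib]
      refine Finset.sum_eq_zero fun l _ => ?_
      have : structureCoeff e de i k l + (connCoeff e de i l k - connCoeff e de i k l) = 0 := by
        unfold connCoeff
        rw [hC i l k, hC l i k, hC k i l]
        ring
      rw [← add_mul, this, zero_mul]

/-- The antisymmetrization `Alt_{abc} T_{abc}`, with the factor `1/3!`. -/
def alt (T : Fin n → Fin n → Fin n → ℝ) (a b c : Fin n) : ℝ :=
  (T a b c + T b c a + T c a b - T b a c - T a c b - T c b a) / 6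

/-! ### Distributional derivatives and singular metrics -/

/-- `f'` is the distributional partial derivative `∂_ν f` on the open set `Ω`. -/
def IsWeakPartial (Ω : Set (Euc n)) (f : Euc n → ℝ) (ν : Fin n) (f' : Euc n → ℝ) : Prop :=
  LocallyIntegrableOn f' Ω volume ∧
  ∀ η : Euc n → ℝ, ContDiff ℝ ∞ η → HasCompactSupport η → tsupport η ⊆ Ω →
    ∫ y in Ω, f y * fderiv ℝ η y (EuclideanSpace.single ν 1) = -∫ y in Ω, f' y * η y

open Classical in
/-- The distributional partial derivative `∂_ν f` on `Ω` as a function (it is unique up to null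
sets); zero if it is not a function. -/
def weakPartial (Ω : Set (Euc n)) (f : Euc n → ℝ) (ν : Fin n) : Euc n → ℝ :=
  if h : ∃ f', IsWeakPartial Ω f ν f' then h.choose else 0

/-- A subset of a manifold has measure zero if it has in all charts. -/
def IsNull (N : Set M) : Prop :=
  ∀ φ ∈ IsManifold.maximalAtlas 𝓘(ℝ, Euc n) ∞ M, volume (φ.target ∩ φ.symm ⁻¹' N) = 0

/-- A possibly singular Riemannian metric on a manifold with spin structure, given by a soldering
form `τ` on `PSpin(M)`: outside of a closed set of measure zero its components in local
coordinates are locally integrable and have distributional first partial derivatives that are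
functions, and it induces an isomorphism `T_xM → ℝⁿ` at almost every point `x`. -/
structure SingularMetric (P : SpinStructure n M) where
  form : P.EquivariantForm
  sing : Set M
  isClosed_sing : IsClosed sing
  isNull_sing : IsNull (n := n) sing
  isNull_degenerate :
    IsNull (n := n) {x | ∃ p : P.Fib x, ¬ Function.Bijective (form.form x p)}
  locallyIntegrable : ∀ (G : P.Gauge) (μ i : Fin n),
    LocallyIntegrableOn (form.comp G μ i) (G.chart.target ∩ G.chart.symm ⁻¹' singᶜ) volume
  exists_weakPartial : ∀ (G : P.Gauge) (μ i ν : Fin n), ∃ f',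
    IsWeakPartial (G.chart.target ∩ G.chart.symm ⁻¹' singᶜ) (form.comp G μ i) ν f'

namespace SingularMetric

variable {P : SpinStructure n M} (g : SingularMetric P) (G : P.Gauge)

/-- The matrix `e_μ^i`, as a function of the coordinates. -/
def vierbein (y : Euc n) : Matrix (Fin n) (Fin n) ℝ :=
  Matrix.of fun μ i => g.form.comp G μ i y

/-- The distributional derivatives `∂_ρ e_μ^i`. -/
def dVierbein (y : Euc n) (ρ μ i : Fin n) : ℝ :=
  weakPartial (G.chart.target ∩ G.chart.symm ⁻¹' g.singᶜ) (g.form.comp G μ i) ρ y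

/-- The dual frame `e_a^μ`. -/
def dualFrame (a μ : Fin n) (y : Euc n) : ℝ := (g.vierbein G y)⁻¹ a μ

/-- The connection components `ω^a_{bμ}`. -/
def omega (a b μ : Fin n) (y : Euc n) : ℝ := connForm (g.vierbein G y) (g.dVierbein G y) a b μ

/-- The connection components `ω_{abc} = ω^a_{bμ} e_c^μ`. -/
def omegaFrame (a b c : Fin n) (y : Euc n) : ℝ := ∑ μ, g.omega G a b μ y * g.dualFrame G c μ y

/-- `∂_μ log |g|`. -/
def dLog (μ : Fin n) (y : Euc n) : ℝ := dLogDet (g.vierbein G y) (g.dVierbein G y) μ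

/-- `|g| = det (g_{μν})`. -/
def absDet (y : Euc n) : ℝ := (metric (g.vierbein G y)).det

/-- The measure `|g|^β dx¹ … dxⁿ` on the image of a chart. -/
def densityMeasure (β : ℝ) : Measure (Euc n) :=
  (volume.restrict G.chart.target).withDensity fun y => ENNReal.ofReal (g.absDet G y ^ β)

/-- A function on the image of a chart is (locally) `L²` with respect to `|g|^{1/4} dx¹ … dxⁿ`:
it is square integrable on all compact subsets. -/
def LocL2 (f : Euc n → ℝ) : Prop :=
  ∀ K ⊆ G.chart.target, IsCompact K →
    MemLp f 2 ((g.densityMeasure G (1 / 4)).restrict K)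

end SingularMetric

/-! ### Integration over `M` -/

/-- A decomposition of `M` into finitely many measurable pieces, each of them relatively compact
in the domain of a chart that carries a local spin frame. It serves to integrate over `M`. -/
structure Dissection (P : SpinStructure n M) where
  card : ℕ
  gauge : Fin card → P.Gauge
  piece : Fin card → Set M
  measurable : ∀ k, MeasurableSet ((gauge k).chart '' piece k)
  relCompact : ∀ k, ∃ K, IsCompact K ∧ piece k ⊆ K ∧ K ⊆ (gauge k).chart.source
  disjoint : Pairwise fun k l => Disjoint (piece k) (piece l)
  union : ⋃ k, piece k = Set.univ

namespace SingularMetric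

variable {P : SpinStructure n M} (g : SingularMetric P)

/-- The metric has finite volume: `∫_M |g|^{1/2} dx¹ … dxⁿ < ∞`. -/
def FiniteVolume : Prop :=
  ∀ D : Dissection P, ∑ k, g.densityMeasure (D.gauge k) (1 / 2)
    ((D.gauge k).chart '' D.piece k) < ⊤

variable {V : Type*} [NormedAddCommGroup V]

/-- The integral `∫_M ⟨Ξ, Ξ⟩ √dvol_g` for a section `Ξ` of `SM ⊗ 𝓓^{1/4}`. The section is given
by its components `Ξ G` in all charts and local spin frames `G`, that is,
`Ξ = Ξ G ⊗ (dx¹ … dxⁿ)^{1/4}`, so that `⟨Ξ, Ξ⟩ √dvol_g = |Ξ G|² |g|^{1/4} dx¹ … dxⁿ`. -/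
def normSq (D : Dissection P) (Ξ : P.Gauge → Euc n → V) : ℝ≥0∞ :=
  ∑ k, ∫⁻ y in (D.gauge k).chart '' D.piece k, ‖Ξ (D.gauge k) y‖ₑ ^ 2
    ∂(g.densityMeasure (D.gauge k) (1 / 4))

/-- Membership in `L²(SM ⊗ 𝓓^{1/4}, √dvol_g)`: the section is measurable and
`∫_M ⟨Ξ, Ξ⟩ √dvol_g < ∞`. -/
def MemL2 (Ξ : P.Gauge → Euc n → V) : Prop :=
  (∀ G, AEStronglyMeasurable (Ξ G) (g.densityMeasure G (1 / 4))) ∧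
  ∀ D : Dissection P, g.normSq D Ξ < ⊤

end SingularMetric

/-! ### Twisted spinors and the Dirac operator -/

variable {V : Type*} [NormedAddCommGroup V] [InnerProductSpace ℂ V] [FiniteDimensional ℂ V]

/-- Smooth sections of `SM ⊗ 𝓓^{1/4}`. A spinor field is a `Spin(n)`-equivariant map from
`PSpin(M)` to `V`, and a quarter density at `x` is a function of `n`-tuples of tangent vectors at
`x` that is multiplied by `|det A|^{1/4}` when an endomorphism `A` is applied to the tuple. -/
structure TwistedSpinor (P : SpinStructure n M) (γ : CliffordMatrices n V) where
  toFun : ∀ x, P.Fib x → (Fin n → TangentSpace 𝓘(ℝ, Euc n) x) → V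
  equivariant : ∀ x (p : P.Fib x) (k : Spin n) (v : Fin n → TangentSpace 𝓘(ℝ, Euc n) x),
    γ.rep (k : Cliff n) (toFun x (P.act p k) v) = toFun x p v
  density : ∀ x (p : P.Fib x) (v : Fin n → TangentSpace 𝓘(ℝ, Euc n) x)
    (A : TangentSpace 𝓘(ℝ, Euc n) x →ₗ[ℝ] TangentSpace 𝓘(ℝ, Euc n) x),
    toFun x p (fun μ => A (v μ)) = |LinearMap.det A| ^ (1 / 4 : ℝ) • toFun x p v
  smooth : ∀ G : P.Gauge, ContDiffOn ℝ ∞ (fun y => toFun (G.chart.symm y)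
    (G.frame (G.chart.symm y)) (coordVector G.chart y)) G.chart.target

/-- The component `ψ` of a twisted spinor `ψ ⊗ (dx¹ … dxⁿ)^{1/4}`. -/
def TwistedSpinor.comp {P : SpinStructure n M} {γ : CliffordMatrices n V}
    (Ψ : TwistedSpinor P γ) (G : P.Gauge) (y : Euc n) : V :=
  Ψ.toFun (G.chart.symm y) (G.frame (G.chart.symm y)) (coordVector G.chart y)

/-- The covariant derivative
`∂_μ ψ + (1/8) ω_{jkμ} [γ^j, γ^k] ψ - (1/2) β (g^{δε} ∂_μ g_{δε}) ψ` of `ψ ⊗ (dx¹ … dxⁿ)^β`. -/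
def SingularMetric.covDeriv {P : SpinStructure n M} (g : SingularMetric P)
    (γ : CliffordMatrices n V) (β : ℝ) (G : P.Gauge) (ψ : Euc n → V) (μ : Fin n) (y : Euc n) :
    V :=
  fderiv ℝ ψ y (EuclideanSpace.single μ 1)
    + (1 / 8 : ℝ) • ∑ j, ∑ k, g.omega G j k μ y •
        (γ.mat j * γ.mat k - γ.mat k * γ.mat j) (ψ y)
    - ((1 / 2 : ℝ) * β * g.dLog G μ y) • ψ y

/-- The Dirac operator on `SM ⊗ 𝓓^{1/4}`: the components of
`- √-1 γ^i e_i^μ ∇_μ Ψ` in all charts and local spin frames. -/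
def SingularMetric.diracHat {P : SpinStructure n M} (g : SingularMetric P)
    (γ : CliffordMatrices n V) (Ψ : TwistedSpinor P γ) (G : P.Gauge) (y : Euc n) : V :=
  -(Complex.I • ∑ i, ∑ μ, g.dualFrame G i μ y •
    γ.mat i (g.covDeriv γ (1 / 4) G (Ψ.comp G) μ y))

end Manifold

end QuarterDensityDirac

end

/-! In a chart with a local spin frame, the Dirac operator is `-√-1` times a first order part `e_i^μ
γ^i ∂_μ ψ` plus a matrix potential `Z ψ`. The antisymmetry of `ω` and the Clifford relations split
the cubic term `¼ ω_{jki} γ^i γ^j γ^k` into a totally antisymmetric part and a trace part. The trace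
part combines with the `log |g|` term, so that `Z = ¼ (Alt ω)_{ijk} γ^i γ^j γ^k + ⅛ t_b γ^b` with
`t_b = 4 e_a^μ ω^a_{bμ} - e_b^μ ∂_μ log |g|` (`sum_triple_eq`, `potential_eq`, `diracHat_eq`). The
three families of functions in the theorem are exactly the coefficients of this normal form.

If these coefficients are `L²` on compact sets, then so is the image of every smooth section,
because `ψ`, its derivatives and the Clifford matrices are bounded on compact sets
(`diracHat_induction`). The pieces over which one integrates are relatively compact in charts, which
gives global square integrability.

Conversely, any smooth function near a compact subset of a chart can be cut off and extended by zero
to a global section (`TwistedSpinor.ofGauge`), so the local expression can be tested on arbitrary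
smooth functions (`memLp_dirac_of_forall_memL2`). Constants give `Z v`, and `y^μ v` then isolates
`e_i^μ γ^i v`. Individual coefficients are recovered algebraically: left and right multiplication by
constant matrices preserves square integrability, and suitable (anti)commutators with the `γ^a`
reduce an expression to one coefficient times the identity (`anticomm_vector`, `iterated_comm_eq`).
A nonzero spinor then turns this into the integrability of a scalar function. -/

namespace QuarterDensityDirac

/-! ### Clifford algebra: normal form and contractions of cubic elements -/

section CliffordIdentities

variable {n : ℕ} {A : Type*} [Ring A] [Algebra ℝ A] {γ : Fin n → A}

lemma clifford_swap (hγ : ∀ i j, γ i * γ j + γ j * γ i = if i = j then 2 else 0) (i j : Fin n) :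
    γ i * γ j = (if i = j then (2 : ℝ) else 0) • (1 : A) - γ j * γ i := by
  rw [eq_sub_iff_add_eq, hγ]
  split_ifs <;> simp [ofNat_smul_eq_nsmul ℝ]

lemma triple_rotate_right (hγ : ∀ i j, γ i * γ j + γ j * γ i = if i = j then 2 else 0)
    (i j k : Fin n) :
    γ k * γ i * γ j = γ i * γ j * γ k + (if k = i then (2 : ℝ) else 0) • γ j
      - (if k = j then (2 : ℝ) else 0) • γ i := by
  rw [clifford_swap hγ k i, sub_mul, mul_assoc (γ i), clifford_swap hγ k j, mul_sub,
    smul_mul_assoc, one_mul, mul_smul_comm, mul_one, mul_assoc]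
  abel

lemma triple_rotate_left (hγ : ∀ i j, γ i * γ j + γ j * γ i = if i = j then 2 else 0)
    (i j k : Fin n) :
    γ j * γ k * γ i = γ i * γ j * γ k + (if k = i then (2 : ℝ) else 0) • γ j
      - (if j = i then (2 : ℝ) else 0) • γ k := by
  rw [mul_assoc, clifford_swap hγ k i, mul_sub, ← mul_assoc, clifford_swap hγ j i, sub_mul,
    smul_mul_assoc, one_mul, mul_smul_comm, mul_one]
  abel

lemma sum_rotate {B : Type*} [AddCommMonoid B] (f : Fin n → Fin n → Fin n → B) :
    ∑ i, ∑ j, ∑ k, f j k i = ∑ i, ∑ j, ∑ k, f i j k := by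
  rw [Finset.sum_comm]
  exact Finset.sum_congr rfl fun _ _ => Finset.sum_comm

/-- The cubic Clifford element of an array that is antisymmetric in its first two indices is the
sum of a totally antisymmetric part and a trace part. -/
lemma sum_triple_eq (hγ : ∀ i j, γ i * γ j + γ j * γ i = if i = j then 2 else 0)
    {w : Fin n → Fin n → Fin n → ℝ} (hw : ∀ i j k, w i j k = -w j i k) :
    ∑ i, ∑ j, ∑ k, w j k i • (γ i * γ j * γ k)
      = ∑ i, ∑ j, ∑ k, alt w i j k • (γ i * γ j * γ k)
        + (2 : ℝ) • ∑ b, (∑ a, w a b a) • γ b := by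
  set L := ∑ i, ∑ j, ∑ k, w j k i • (γ i * γ j * γ k) with hL
  set S := ∑ b, (∑ a, w a b a) • γ b with hS
  have hdiag : ∀ i j, w j j i = 0 := fun i j => by linarith [hw j j i]
  have hS' : ∑ i, ∑ j, w j i i • γ j = -S := by
    rw [Finset.sum_comm, hS, ← Finset.sum_neg_distrib]
    refine Finset.sum_congr rfl fun j _ => ?_
    rw [← Finset.sum_smul, ← neg_smul, ← Finset.sum_neg_distrib]
    simp only [← hw]
  -- Both contractions produced by the rotation are traces of `w`, and each contributes `-2 S`. For
  -- the other rotation, in `hA2`, one of the two contractions is the vanishing diagonal `w j j i`.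
  have hA1 : ∑ i, ∑ j, ∑ k, w i j k • (γ i * γ j * γ k) = L - (4 : ℝ) • S := by
    have h2 : ∑ i, ∑ k, w i k i • γ k = S := by
      rw [Finset.sum_comm]; simp only [hS, Finset.sum_smul]
    rw [← sum_rotate fun i j k => w i j k • (γ i * γ j * γ k)]
    rw [Finset.sum_congr rfl fun i _ => Finset.sum_congr rfl fun j _ => Finset.sum_congr rfl
      fun k _ => congrArg (w j k i • ·) (triple_rotate_left hγ i j k)]
    simp only [smul_sub, smul_add, Finset.sum_sub_distrib,
      Finset.sum_add_distrib, ← hL, ite_smul, zero_smul, smul_ite, smul_zero, Finset.sum_ite_eq',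
      Finset.sum_ite_irrel, Finset.sum_const_zero, Finset.mem_univ, if_true,
      smul_comm _ (2 : ℝ), ← Finset.smul_sum, hS', h2]
    module
  have hA2 : ∑ i, ∑ j, ∑ k, w k i j • (γ i * γ j * γ k) = L - (2 : ℝ) • S := by
    rw [← sum_rotate fun i j k => w k i j • (γ i * γ j * γ k),
      ← sum_rotate fun i j k => w i j k • (γ j * γ k * γ i)]
    rw [Finset.sum_congr rfl fun i _ => Finset.sum_congr rfl fun j _ => Finset.sum_congr rfl
      fun k _ => congrArg (w j k i • ·) (triple_rotate_right hγ i j k)]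
    simp only [smul_sub, smul_add, Finset.sum_sub_distrib,
      Finset.sum_add_distrib, ← hL, ite_smul, zero_smul, smul_ite, smul_zero, Finset.sum_ite_eq',
      Finset.sum_const_zero, Finset.mem_univ, if_true,
      smul_comm _ (2 : ℝ), ← Finset.smul_sum, hS', hdiag]
    module
  -- Antisymmetry in the first pair reduces the six terms to the cyclic sum, so the cubic element of
  -- `alt w` is `((L - 4 S) + L + (L - 2 S)) / 3 = L - 2 S`.
  have halt : ∀ i j k, alt w i j k = (1 / 3 : ℝ) * w i j k + (1 / 3 : ℝ) * w j k i
      + (1 / 3 : ℝ) * w k i j := fun i j k => by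
    unfold alt
    rw [hw j i k, hw i k j, hw k j i]
    ring
  simp only [halt, add_smul, Finset.sum_add_distrib, mul_smul, ← Finset.smul_sum, hA1, hA2, ← hL]
  module

lemma alt_swap_left (w : Fin n → Fin n → Fin n → ℝ) (i j k : Fin n) :
    alt w i j k = -alt w j i k := by
  unfold alt; ring

lemma alt_swap_right (w : Fin n → Fin n → Fin n → ℝ) (i j k : Fin n) :
    alt w i j k = -alt w i k j := by
  unfold alt; ring

/-- Contraction of a cubic Clifford element with a vector. -/
lemma anticomm_triple (hγ : ∀ i j, γ i * γ j + γ j * γ i = if i = j then 2 else 0)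
    {T : Fin n → Fin n → Fin n → ℝ} (h12 : ∀ i j k, T i j k = -T j i k)
    (h23 : ∀ i j k, T i j k = -T i k j) (a : Fin n) :
    γ a * (∑ i, ∑ j, ∑ k, T i j k • (γ i * γ j * γ k))
      + (∑ i, ∑ j, ∑ k, T i j k • (γ i * γ j * γ k)) * γ a
      = (6 : ℝ) • ∑ j, ∑ k, T a j k • (γ j * γ k) := by
  -- Moving `γ a` past three factors changes the sign three times, so in the anticommutator only the
  -- contractions survive. By total antisymmetry the three of them agree after summation, whence `3
  -- · 2 = 6`.
  have key : ∀ i j k, γ a * (γ i * γ j * γ k) + γ i * γ j * γ k * γ a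
      = (if a = i then (2 : ℝ) else 0) • (γ j * γ k) - (if a = j then (2 : ℝ) else 0) • (γ i * γ k)
        + (if a = k then (2 : ℝ) else 0) • (γ i * γ j) := fun i j k => by
    have e1 := clifford_swap hγ a i
    have e2 := clifford_swap hγ a j
    have e3 := clifford_swap hγ a k
    have : γ a * (γ i * γ j * γ k) = (γ a * γ i) * γ j * γ k := by noncomm_ring
    rw [this, e1, sub_mul, sub_mul, smul_mul_assoc, one_mul, mul_assoc (γ i), e2, mul_sub, sub_mul,
      mul_smul_comm, mul_one, ← mul_assoc, mul_assoc (γ i * γ j), e3, mul_sub, mul_smul_comm,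
      mul_one, ← mul_assoc, smul_mul_assoc, smul_mul_assoc]
    abel
  have h2 : ∀ i k, T i a k = -T a i k := fun i k => h12 i a k
  have h3 : ∀ i j, T i j a = T a i j := fun i j => by rw [h23, h12, neg_neg]
  simp only [Finset.mul_sum, Finset.sum_mul, mul_smul_comm, smul_mul_assoc,
    ← Finset.sum_add_distrib, ← smul_add, key]
  simp only [smul_sub, smul_add, Finset.sum_sub_distrib,
      Finset.sum_add_distrib, ite_smul, zero_smul, smul_ite, smul_zero, Finset.sum_ite_eq,
      Finset.sum_ite_irrel, Finset.sum_const_zero, Finset.mem_univ, if_true,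
      smul_comm _ (2 : ℝ), ← Finset.smul_sum, h2, h3, neg_smul, Finset.sum_neg_distrib, smul_neg]
  module

/-- Contraction of a quadratic Clifford element with a vector. -/
lemma comm_pair (hγ : ∀ i j, γ i * γ j + γ j * γ i = if i = j then 2 else 0)
    {T : Fin n → Fin n → ℝ} (hT : ∀ i j, T i j = -T j i) (a : Fin n) :
    γ a * (∑ i, ∑ j, T i j • (γ i * γ j)) - (∑ i, ∑ j, T i j • (γ i * γ j)) * γ a
      = (4 : ℝ) • ∑ j, T a j • γ j := by
  -- For an even element it is the commutator that leaves only the contractions.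
  have key : ∀ i j, γ a * (γ i * γ j) - γ i * γ j * γ a
      = (if a = i then (2 : ℝ) else 0) • γ j - (if a = j then (2 : ℝ) else 0) • γ i :=
      fun i j => by
    rw [← mul_assoc, clifford_swap hγ a i, sub_mul, smul_mul_assoc, one_mul, mul_assoc (γ i),
      clifford_swap hγ a j, mul_sub, mul_smul_comm, mul_one, ← mul_assoc]
    abel
  simp only [Finset.mul_sum, Finset.sum_mul, mul_smul_comm, smul_mul_assoc,
    ← Finset.sum_sub_distrib, ← smul_sub, key]
  simp only [smul_sub, Finset.sum_sub_distrib, ite_smul, zero_smul, smul_ite, smul_zero,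
      Finset.sum_ite_eq, Finset.sum_ite_irrel, Finset.sum_const_zero, Finset.mem_univ, if_true,
      smul_comm _ (2 : ℝ), ← Finset.smul_sum, hT _ a, neg_smul, Finset.sum_neg_distrib, smul_neg]
  module

/-- Contraction of two vectors. -/
lemma anticomm_vector (hγ : ∀ i j, γ i * γ j + γ j * γ i = if i = j then 2 else 0)
    (c : Fin n → ℝ) (a : Fin n) :
    γ a * (∑ b, c b • γ b) + (∑ b, c b • γ b) * γ a = (2 * c a) • (1 : A) := by
  simp only [Finset.mul_sum, Finset.sum_mul, mul_smul_comm, smul_mul_assoc,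
    ← Finset.sum_add_distrib, ← smul_add]
  have key : ∀ b, γ a * γ b + γ b * γ a = (if a = b then (2 : ℝ) else 0) • (1 : A) := fun b => by
    rw [clifford_swap hγ a b, sub_add_cancel]
  simp only [key, ite_smul, zero_smul, smul_ite, smul_zero, Finset.sum_ite_eq, Finset.mem_univ,
    if_true, smul_smul, mul_comm]

/-- The coefficients of the cubic part of a Clifford element with cubic and linear terms, as an
iterated commutator. -/
lemma iterated_comm_eq (hγ : ∀ i j, γ i * γ j + γ j * γ i = if i = j then 2 else 0)
    {T : Fin n → Fin n → Fin n → ℝ} (h12 : ∀ i j k, T i j k = -T j i k)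
    (h23 : ∀ i j k, T i j k = -T i k j) (c : Fin n → ℝ) {Z X : A}
    (hZ : Z = (1 / 4 : ℝ) • ∑ i, ∑ j, ∑ k, T i j k • (γ i * γ j * γ k)
      + (1 / 8 : ℝ) • ∑ b, c b • γ b) (a b d : Fin n)
    (hX : X = γ b * (γ a * Z + Z * γ a) - (γ a * Z + Z * γ a) * γ b) :
    γ d * X + X * γ d = (12 * T a b d) • (1 : A) := by
  -- The cubic part becomes quadratic, with `3/2 = 6 · ¼`, and the linear part becomes a scalar.
  have h1 : γ a * Z + Z * γ a
      = (3 / 2 : ℝ) • ∑ j, ∑ k, T a j k • (γ j * γ k) + (c a / 4) • (1 : A) := by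
    have e1 := anticomm_triple hγ h12 h23 a
    have e2 := anticomm_vector hγ c a
    rw [hZ, mul_add, add_mul, mul_smul_comm, mul_smul_comm, smul_mul_assoc, smul_mul_assoc,
      add_add_add_comm, ← smul_add, ← smul_add, e1, e2]
    module
  -- The commutator removes the scalar, and with it `c`; the constant is `6 = 4 · 3/2`. The last
  -- anticommutator doubles it to `12`.
  have h2 : X = (6 : ℝ) • ∑ k, T a b k • γ k := by
    have e1 := comm_pair hγ (T := T a) (fun i j => h23 a i j) b
    rw [hX, h1, mul_add, add_mul, mul_smul_comm, mul_smul_comm, smul_mul_assoc, smul_mul_assoc,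
      add_sub_add_comm, ← smul_sub, e1, mul_one, one_mul]
    module
  rw [h2, mul_smul_comm, smul_mul_assoc, ← smul_add, anticomm_vector hγ]
  module

end CliffordIdentities

/-! ### Square integrability of operator-valued functions -/

section SquareIntegrable

variable {α : Type*} [MeasurableSpace α] {μ : Measure α}
variable {V : Type*} [NormedAddCommGroup V] [InnerProductSpace ℂ V]

/-- An operator-valued function is square integrable on all constant vectors. -/
def PointwiseL2 (μ : Measure α) (Z : α → V →L[ℂ] V) : Prop := ∀ v, MemLp (fun y => Z y v) 2 μ

namespace PointwiseL2

variable {Z W : α → V →L[ℂ] V}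

lemma add (hZ : PointwiseL2 μ Z) (hW : PointwiseL2 μ W) : PointwiseL2 μ fun y => Z y + W y :=
  fun v => (hZ v).add (hW v)

lemma sub (hZ : PointwiseL2 μ Z) (hW : PointwiseL2 μ W) : PointwiseL2 μ fun y => Z y - W y :=
  fun v => (hZ v).sub (hW v)

lemma const_mul (hZ : PointwiseL2 μ Z) (A : V →L[ℂ] V) : PointwiseL2 μ fun y => A * Z y :=
  fun v => A.comp_memLp' (hZ v)

/-- This closure property is the reason for testing on all constant vectors: `B v` is again one of
them. Together with `const_mul` it makes commutators and anticommutators with Clifford matrices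
available. -/
lemma mul_const (hZ : PointwiseL2 μ Z) (B : V →L[ℂ] V) : PointwiseL2 μ fun y => Z y * B :=
  fun v => hZ (B v)

lemma const_smul (hZ : PointwiseL2 μ Z) (r : ℝ) : PointwiseL2 μ fun y => r • Z y :=
  fun v => (hZ v).const_smul r

lemma of_memLp {f : α → ℝ} (hf : MemLp f 2 μ) (A : V →L[ℂ] V) : PointwiseL2 μ fun y => f y • A :=
  fun v => ((ContinuousLinearMap.id ℝ ℝ).smulRight (A v)).comp_memLp' hf

lemma sum {ι : Type*} (s : Finset ι) {Z : ι → α → V →L[ℂ] V}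
    (hZ : ∀ i ∈ s, PointwiseL2 μ (Z i)) : PointwiseL2 μ fun y => ∑ i ∈ s, Z i y := fun v => by
  simpa only [sum_apply] using memLp_finsetSum s fun i hi => hZ i hi v

/-- A real functional that takes the value `1` at some `v ≠ 0` recovers `f` from `f • v`. -/
lemma memLp_of_smul_one [Nontrivial V] {f : α → ℝ}
    (h : PointwiseL2 μ fun y => f y • (1 : V →L[ℂ] V)) : MemLp f 2 μ := by
  obtain ⟨v, hv⟩ := exists_ne (0 : V)
  obtain ⟨L, hL⟩ := SeparatingDual.exists_eq_one (R := ℝ) hv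
  have := L.comp_memLp' (h v)
  simpa [Function.comp_def, hL] using this

end PointwiseL2

lemma MemLp.continuousOn_smul {X E : Type*} [TopologicalSpace X] [MeasurableSpace X]
    [OpensMeasurableSpace X] [NormedAddCommGroup E] [NormedSpace ℝ E] [T2Space X] {ν : Measure X}
    [SecondCountableTopology E]
    {K : Set X} (hK : IsCompact K) {f : X → ℝ} (hf : MemLp f 2 (ν.restrict K)) {h : X → E}
    (hh : ContinuousOn h K) : MemLp (fun y => f y • h y) 2 (ν.restrict K) := by
  obtain ⟨C, hC⟩ := hK.exists_bound_of_continuousOn hh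
  have hhm : AEStronglyMeasurable h (ν.restrict K) := by
    borelize E
    exact (hh.aemeasurable hK.measurableSet).aestronglyMeasurable
  refine hf.of_le_mul (c := C) (hf.1.smul hhm) ?_
  filter_upwards [ae_restrict_mem hK.measurableSet] with y hy
  rw [norm_smul, mul_comm]
  gcongr
  exact hC y hy

end SquareIntegrable

/-! ### Measurability of the geometric coefficients -/

section Measurability

variable {α : Type*} [MeasurableSpace α] {μ : Measure α} {n : ℕ}

lemma aemeasurable_det {A : α → Matrix (Fin n) (Fin n) ℝ}
    (hA : ∀ i j, AEMeasurable (fun y => A y i j) μ) : AEMeasurable (fun y => (A y).det) μ := by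
  simp only [Matrix.det_apply']
  fun_prop

lemma aemeasurable_inv {A : α → Matrix (Fin n) (Fin n) ℝ}
    (hA : ∀ i j, AEMeasurable (fun y => A y i j) μ) (i j : Fin n) :
    AEMeasurable (fun y => (A y)⁻¹ i j) μ := by
  -- Cramer's rule writes each entry as a quotient of determinants; as inversion in `ℝ` is total and
  -- measurable, singular matrices need no separate treatment.
  simp only [Matrix.inv_def, Matrix.smul_apply, Ring.inverse_eq_inv', Matrix.adjugate_apply,
    smul_eq_mul]
  refine (aemeasurable_det hA).inv.mul (aemeasurable_det fun k l => ?_)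
  simp only [Matrix.updateRow_apply]
  split_ifs
  · exact aemeasurable_const
  · exact hA k l

variable {e : α → Matrix (Fin n) (Fin n) ℝ} {de : α → Fin n → Fin n → Fin n → ℝ}

lemma aemeasurable_connForm (he : ∀ i j, AEMeasurable (fun y => e y i j) μ)
    (hde : ∀ i j k, AEMeasurable (fun y => de y i j k) μ) (i j k : Fin n) :
    AEMeasurable (fun y => connForm (e y) (de y) i j k) μ := by
  have hs : ∀ i k l, AEMeasurable (fun y => structureCoeff (e y) (de y) i k l) μ := fun i k l =>
    Finset.aemeasurable_fun_sum _ fun ρ _ => Finset.aemeasurable_fun_sum _ fun σ _ =>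
      ((aemeasurable_inv he k ρ).mul (aemeasurable_inv he l σ)).mul
        ((hde ρ σ i).sub (hde σ ρ i))
  exact Finset.aemeasurable_fun_sum _ fun l _ =>
    ((((hs i j l).add (hs j l i)).sub (hs l i j)).div_const 2).mul (he k l)

lemma aemeasurable_dLogDet (he : ∀ i j, AEMeasurable (fun y => e y i j) μ)
    (hde : ∀ i j k, AEMeasurable (fun y => de y i j k) μ) (i : Fin n) :
    AEMeasurable (fun y => dLogDet (e y) (de y) i) μ := by
  have hm : ∀ i j, AEMeasurable (fun y => metric (e y) i j) μ := fun i j => by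
    simp only [metric, Matrix.of_apply]
    fun_prop
  exact Finset.aemeasurable_fun_sum _ fun k _ => Finset.aemeasurable_fun_sum _ fun l _ =>
    (aemeasurable_inv hm k l).mul <| Finset.aemeasurable_fun_sum _ fun m _ =>
      ((hde i k m).mul (he l m)).add ((he k m).mul (hde i l m))

end Measurability

/-! ### The Dirac operator in Clifford normal form -/

section Metric

variable {n : ℕ} {M : Type*} [TopologicalSpace M] [ChartedSpace (Euc n) M]
  {P : SpinStructure n M} (g : SingularMetric P) (G : P.Gauge)

namespace SingularMetric

/-- The singular set is null, so measurability on its complement, where the frame and its weak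
derivatives are controlled, is measurability on the whole chart. -/
lemma restrict_regular_eq :
    volume.restrict (G.chart.target ∩ G.chart.symm ⁻¹' g.singᶜ)
      = volume.restrict G.chart.target := by
  refine Measure.restrict_congr_set ?_
  have h := g.isNull_sing G.chart G.chart_mem
  rw [Set.preimage_compl, ← Set.sdiff_eq, ← Set.sdiff_self_inter]
  exact sdiff_null_ae_eq_self h

lemma densityMeasure_absolutelyContinuous (β : ℝ) :
    g.densityMeasure G β ≪ volume.restrict G.chart.target :=
  withDensity_absolutelyContinuous _ _

lemma aemeasurable_vierbein (β : ℝ) (μ i : Fin n) :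
    AEMeasurable (fun y => g.vierbein G y μ i) (g.densityMeasure G β) := by
  refine AEMeasurable.mono_ac ?_ (g.densityMeasure_absolutelyContinuous G β)
  rw [← g.restrict_regular_eq G]
  exact (g.locallyIntegrable G μ i).aestronglyMeasurable.aemeasurable

lemma aemeasurable_dVierbein (β : ℝ) (ρ μ i : Fin n) :
    AEMeasurable (fun y => g.dVierbein G y ρ μ i) (g.densityMeasure G β) := by
  refine AEMeasurable.mono_ac ?_ (g.densityMeasure_absolutelyContinuous G β)
  rw [← g.restrict_regular_eq G]
  have h := g.exists_weakPartial G μ i ρ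
  simp only [dVierbein, weakPartial, dif_pos h]
  exact h.choose_spec.1.aestronglyMeasurable.aemeasurable

lemma aemeasurable_dualFrame (β : ℝ) (a μ : Fin n) :
    AEMeasurable (g.dualFrame G a μ) (g.densityMeasure G β) :=
  aemeasurable_inv (g.aemeasurable_vierbein G β) a μ

lemma aemeasurable_omega (β : ℝ) (a b μ : Fin n) :
    AEMeasurable (g.omega G a b μ) (g.densityMeasure G β) :=
  aemeasurable_connForm (g.aemeasurable_vierbein G β) (g.aemeasurable_dVierbein G β) a b μ

lemma aemeasurable_dLog (β : ℝ) (μ : Fin n) :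
    AEMeasurable (g.dLog G μ) (g.densityMeasure G β) :=
  aemeasurable_dLogDet (g.aemeasurable_vierbein G β) (g.aemeasurable_dVierbein G β) μ

end SingularMetric

lemma structureCoeff_swap (e : Matrix (Fin n) (Fin n) ℝ) (de : Fin n → Fin n → Fin n → ℝ)
    (i k l : Fin n) : structureCoeff e de i k l = -structureCoeff e de i l k := by
  unfold structureCoeff
  rw [Finset.sum_comm, ← Finset.sum_neg_distrib]
  refine Finset.sum_congr rfl fun ρ _ => ?_
  rw [← Finset.sum_neg_distrib]
  exact Finset.sum_congr rfl fun σ _ => by ring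

/-- The antisymmetry is built into the formula for `connCoeff`, so it holds also at degenerate
points. The normal form below is therefore an identity at every point, not only almost everywhere.
-/
lemma connForm_swap (e : Matrix (Fin n) (Fin n) ℝ) (de : Fin n → Fin n → Fin n → ℝ)
    (i j μ : Fin n) : connForm e de i j μ = -connForm e de j i μ := by
  simp only [connForm, ← Finset.sum_neg_distrib]
  refine Finset.sum_congr rfl fun k _ => ?_
  unfold connCoeff
  rw [structureCoeff_swap e de i j k, structureCoeff_swap e de j i k,
    structureCoeff_swap e de k i j]
  ring

variable {V : Type*} [NormedAddCommGroup V] [InnerProductSpace ℂ V] [FiniteDimensional ℂ V]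
  (γ : CliffordMatrices n V)

namespace SingularMetric

lemma omegaFrame_swap (a b c : Fin n) (y : Euc n) :
    g.omegaFrame G a b c y = -g.omegaFrame G b a c y := by
  simp only [omegaFrame, ← Finset.sum_neg_distrib, ← neg_mul]
  exact Finset.sum_congr rfl fun μ _ => by rw [omega, connForm_swap]; rfl

/-- The totally antisymmetric part of the connection. -/
noncomputable def altOmega (a b c : Fin n) (y : Euc n) : ℝ :=
  alt (fun i j k => g.omegaFrame G i j k y) a b c

/-- The vector part of the zeroth order term of the Dirac operator, up to a constant. -/
noncomputable def traceTerm (b : Fin n) (y : Euc n) : ℝ :=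
  4 * ∑ a, ∑ μ, g.dualFrame G a μ y * g.omega G a b μ y
    - ∑ μ, g.dualFrame G b μ y * g.dLog G μ y

/-- The zeroth order term of the Dirac operator on quarter density spinors. -/
noncomputable def potential (y : Euc n) : V →L[ℂ] V :=
  (1 / 4 : ℝ) • ∑ i, ∑ j, ∑ k, g.altOmega G i j k y • (γ.mat i * γ.mat j * γ.mat k)
    + (1 / 8 : ℝ) • ∑ b, g.traceTerm G b y • γ.mat b

/-- Contracted with the antisymmetric `ω_{jk}`, the commutator counts the product twice, which turns
`1/8` into `1/4`. -/
lemma sum_omega_comm_eq (i : Fin n) (y : Euc n) :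
    ∑ μ, g.dualFrame G i μ y • (γ.mat i * ((1 / 8 : ℝ) • ∑ j, ∑ k, g.omega G j k μ y •
        (γ.mat j * γ.mat k - γ.mat k * γ.mat j)))
      = (1 / 4 : ℝ) • ∑ j, ∑ k, g.omegaFrame G j k i y • (γ.mat i * γ.mat j * γ.mat k) := by
  have h1 : ∀ μ, ∑ j, ∑ k, g.omega G j k μ y • (γ.mat j * γ.mat k - γ.mat k * γ.mat j)
      = (2 : ℝ) • ∑ j, ∑ k, g.omega G j k μ y • (γ.mat j * γ.mat k) := fun μ => by
    have : ∑ j, ∑ k, g.omega G j k μ y • (γ.mat k * γ.mat j)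
        = -∑ j, ∑ k, g.omega G j k μ y • (γ.mat j * γ.mat k) := by
      rw [Finset.sum_comm]
      simp only [← Finset.sum_neg_distrib, ← neg_smul]
      exact Finset.sum_congr rfl fun j _ => Finset.sum_congr rfl fun k _ => by
        rw [omega, connForm_swap]; rfl
    simp only [smul_sub, Finset.sum_sub_distrib, this]
    module
  simp only [h1, mul_smul_comm, omegaFrame, Finset.sum_smul, Finset.mul_sum, Finset.smul_sum]
  rw [Finset.sum_comm]
  refine Finset.sum_congr rfl fun j _ => ?_
  rw [Finset.sum_comm]
  refine Finset.sum_congr rfl fun k _ => Finset.sum_congr rfl fun μ _ => ?_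
  rw [mul_assoc]
  module

/-- The trace part from `sum_triple_eq` has coefficient `2 · ¼ = ⅛ · 4`, and the density term has `½
· ¼ = ⅛`; this is how both fit into the single vector `traceTerm`. -/
lemma potential_eq (y : Euc n) :
    g.potential G γ y = ∑ i, ∑ μ, g.dualFrame G i μ y • (γ.mat i * ((1 / 8 : ℝ) • ∑ j, ∑ k,
      g.omega G j k μ y • (γ.mat j * γ.mat k - γ.mat k * γ.mat j)
      - ((1 / 2 : ℝ) * (1 / 4) * g.dLog G μ y) • 1)) := by
  have h := sum_triple_eq γ.anticomm (w := fun i j k => g.omegaFrame G i j k y)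
    fun i j k => g.omegaFrame_swap G i j k y
  simp only [mul_sub (γ.mat _), smul_sub (g.dualFrame G _ _ y), Finset.sum_sub_distrib (f := fun μ =>
    g.dualFrame G _ μ y • _), sum_omega_comm_eq]
  rw [Finset.sum_sub_distrib]
  rw [← Finset.smul_sum, h]
  have h2 : ∀ b, ∑ a, g.omegaFrame G a b a y
      = ∑ a, ∑ μ, g.dualFrame G a μ y * g.omega G a b μ y := fun b =>
    Finset.sum_congr rfl fun a _ => Finset.sum_congr rfl fun μ _ => mul_comm _ _
  have h3 : ∑ i, ∑ μ, g.dualFrame G i μ y • (γ.mat i * (((1 / 2 : ℝ) * (1 / 4) * g.dLog G μ y) •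
      (1 : V →L[ℂ] V))) = (1 / 8 : ℝ) • ∑ i, (∑ μ, g.dualFrame G i μ y * g.dLog G μ y) • γ.mat i := by
    simp only [Finset.smul_sum, Finset.sum_smul, mul_smul_comm, mul_one]
    exact Finset.sum_congr rfl fun j _ => Finset.sum_congr rfl fun k _ => by module
  rw [h3]
  simp only [h2, potential, traceTerm, sub_smul, Finset.sum_sub_distrib, mul_smul,
    ← Finset.smul_sum]
  unfold altOmega
  module

lemma diracHat_eq (Ψ : TwistedSpinor P γ) (y : Euc n) :
    g.diracHat γ Ψ G y = -(Complex.I • (∑ i, ∑ μ, g.dualFrame G i μ y •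
      γ.mat i (fderiv ℝ (Ψ.comp G) y (EuclideanSpace.single μ 1))
        + g.potential G γ y (Ψ.comp G y))) := by
  rw [diracHat, potential_eq]
  congr 2
  simp only [sum_apply, ← Finset.sum_add_distrib, smul_apply, ← smul_add]
  refine Finset.sum_congr rfl fun i _ => Finset.sum_congr rfl fun μ _ => ?_
  congr 1
  rw [mul_apply_eq_comp, ← map_add]
  simp only [covDeriv, sum_apply, smul_apply, sub_apply, one_apply_eq_self, add_sub_assoc]

end SingularMetric

end Metric

/-! ### Dissections adapted to a compact subset of a chart -/

section Dissection

variable {n : ℕ} {M : Type*} [TopologicalSpace M] [ChartedSpace (Euc n) M]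

lemma SpinBundle.exists_gauge [IsManifold 𝓘(ℝ, Euc n) ∞ M] (B : SpinBundle n M) (x : M) :
    ∃ G : B.Gauge, x ∈ G.chart.source := by
  obtain ⟨f, hf, hx⟩ := B.cover x
  have ho := B.isOpen_of_mem f hf
  have hsub : ((chartAt (Euc n) x).restr f.1).source ⊆ f.1 := by
    rw [OpenPartialHomeomorph.restr_source' _ _ ho]
    exact Set.inter_subset_right
  refine ⟨⟨(chartAt (Euc n) x).restr f.1, ?_, f.2, fun f' hf' => ?_⟩, ?_⟩
  · exact restr_mem_maximalAtlas _ (IsManifold.chart_mem_maximalAtlas x) ho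
  · obtain ⟨k, hk, hk'⟩ := B.smooth_transition f' hf' f hf
    refine ⟨k, fun l => (hk l).mono ?_, fun y hy => hk' y ⟨hy.2, hsub hy.1⟩⟩
    exact fun y hy => ⟨hy.2, hsub hy.1⟩
  · rw [OpenPartialHomeomorph.restr_source' _ _ ho]
    exact ⟨mem_chart_source _ x, hx⟩

/-- Compact subsets of chart domains that cover the manifold can be made disjoint. -/
lemma SpinStructure.exists_dissection_of_cover [T2Space M] (P : SpinStructure n M) {m : ℕ}
    (G : Fin m → P.Gauge) (C : Fin m → Set M) (hC : ∀ i, IsCompact (C i))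
    (hCG : ∀ i, C i ⊆ (G i).chart.source) (hU : ⋃ i, C i = Set.univ) :
    ∃ D : Dissection P, ∃ h : D.card = m, ∀ i, D.gauge i = G (i.cast h) ∧
      D.piece i = disjointed C (i.cast h) := by
  refine ⟨⟨m, G, disjointed C, fun k => ?_, fun k => ⟨C k, hC k, disjointed_subset C k, hCG k⟩,
    disjoint_disjointed C, by rw [iUnion_disjointed, hU]⟩, rfl, fun i => ⟨rfl, rfl⟩⟩
  rw [disjointed_apply]
  set E := (Finset.Iio k).sup C
  have hE : IsClosed E := by
    rw [show E = ⋃ i ∈ Finset.Iio k, C i from Finset.sup_eq_iSup _ _]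
    exact isClosed_biUnion_finset fun i _ => (hC i).isClosed
  have hcomp : ∀ T ⊆ C k, IsCompact T → IsCompact ((G k).chart '' T) := fun T hT h =>
    h.image_of_continuousOn ((G k).chart.continuousOn.mono (hT.trans (hCG k)))
  -- By injectivity of the chart on `C k`, the image of the difference is a difference of two
  -- compact sets.
  rw [show C k \ E = C k \ (C k ∩ E) by simp,
    ((G k).chart.injOn.mono (hCG k)).image_sdiff_subset Set.inter_subset_left]
  exact (hcomp _ subset_rfl (hC k)).measurableSet.diff
    (hcomp _ Set.inter_subset_left ((hC k).inter_right hE)).measurableSet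

/-- Every compact subset of a chart is a piece of a dissection. -/
lemma SpinStructure.exists_dissection [IsManifold 𝓘(ℝ, Euc n) ∞ M] [T2Space M] [CompactSpace M]
    (P : SpinStructure n M) (G : P.Gauge) {K : Set (Euc n)}
    (hK : IsCompact K) (hKG : K ⊆ G.chart.target) :
    ∃ D : Dissection P, ∃ k, D.gauge k = G ∧ (D.gauge k).chart '' D.piece k = K := by
  choose Gx hGx using P.exists_gauge
  choose C hCx hCG hC using fun x =>
    local_compact_nhds ((Gx x).chart.open_source.mem_nhds (hGx x))
  obtain ⟨t, ht⟩ := CompactSpace.elim_nhds_subcover C hCx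
  let e := t.equivFin.symm
  -- The given compact set gets index `0`, because `disjointed` leaves the first set unchanged.
  let G' : Fin (t.card + 1) → P.Gauge := Fin.cons G fun i => Gx (e i)
  let C' : Fin (t.card + 1) → Set M := Fin.cons (G.chart.symm '' K) fun i => C (e i)
  obtain ⟨D, h, hD⟩ := P.exists_dissection_of_cover G' C'
    (Fin.cases (hK.image_of_continuousOn (G.chart.continuousOn_symm.mono hKG))
      fun i => hC _)
    (Fin.cases (by
      rintro _ ⟨y, hy, rfl⟩
      exact G.chart.map_target (hKG hy)) fun i => hCG _)
    (by
      refine Set.eq_univ_of_univ_subset fun x _ => ?_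
      have : x ∈ ⋃ y ∈ t, C y := ht ▸ Set.mem_univ x
      obtain ⟨y, hy, hxy⟩ := Set.mem_iUnion₂.1 this
      refine Set.mem_iUnion.2 ⟨(t.equivFin ⟨y, hy⟩).succ, ?_⟩
      simpa [C', e] using hxy)
  refine ⟨D, (0 : Fin (t.card + 1)).cast h.symm, ?_⟩
  rw [(hD _).1, (hD _).2]
  refine ⟨rfl, ?_⟩
  rw [Fin.cast_cast, Fin.cast_refl, id, show disjointed C' 0 = C' 0 from disjointed_bot C']
  change G.chart '' (G.chart.symm '' K) = K
  rw [Set.image_image]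
  exact (Set.image_congr fun y hy => G.chart.right_inv (hKG hy)).trans (Set.image_id' K)

end Dissection

/-! ### Smooth dependence of the change of spin frame -/

section FrameChange

variable {n : ℕ} {M : Type*} [TopologicalSpace M] [ChartedSpace (Euc n) M]

namespace SpinBundle

variable (B : SpinBundle n M) {x : M}

/-- The element of the spin group that moves `p` to `q`. -/
noncomputable def frameChange (p q : B.Fib x) : Spin n := (B.existsUnique_act p q).choose

lemma act_frameChange (p q : B.Fib x) : B.act p (B.frameChange p q) = q :=
  (B.existsUnique_act p q).choose_spec.1.symm

lemma frameChange_eq {p q : B.Fib x} {k : Spin n} (h : B.act p k = q) :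
    B.frameChange p q = k :=
  (B.existsUnique_act p q).unique (B.act_frameChange p q).symm h.symm

lemma frameChange_self (p : B.Fib x) : B.frameChange p p = 1 :=
  B.frameChange_eq (B.act_one p)

lemma frameChange_act (p q : B.Fib x) (k : Spin n) :
    B.frameChange p (B.act q k) = B.frameChange p q * k :=
  B.frameChange_eq (by rw [B.act_mul, B.act_frameChange])

lemma frameChange_act_act (p : B.Fib x) (k l : Spin n) :
    B.frameChange (B.act p k) (B.act p l) = k⁻¹ * l :=
  B.frameChange_eq (by rw [← B.act_mul, mul_inv_cancel_left])

end SpinBundle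

/-- Linear functions of a smooth map to the spin group are smooth in coordinates. -/
lemma SmoothSpinOn.contDiffOn_linear {k : M → Spin n} {U : Set M} (hk : SmoothSpinOn k U)
    {φ : OpenPartialHomeomorph M (Euc n)} (hφ : φ ∈ IsManifold.maximalAtlas 𝓘(ℝ, Euc n) ∞ M)
    {E : Type*} [NormedAddCommGroup E] [NormedSpace ℝ E] [FiniteDimensional ℝ E]
    (L : Cliff n →ₗ[ℝ] E) :
    ContDiffOn ℝ ∞ (fun y => L (k (φ.symm y) : Cliff n)) (φ.target ∩ φ.symm ⁻¹' U) := by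
  let e := (Module.finBasis ℝ E).equivFun.toContinuousLinearEquiv
  refine e.comp_contDiffOn_iff.1 (contDiffOn_pi.2 fun i => ?_)
  have h := (hk (LinearMap.proj i ∘ₗ e.toLinearMap ∘ₗ L)).comp
    ((contMDiffOn_symm_of_mem_maximalAtlas hφ).mono (Set.inter_subset_left (t := φ.symm ⁻¹' U)))
    fun y hy => hy.2
  exact contMDiffOn_iff_contDiffOn.1 h

variable {V : Type*} [NormedAddCommGroup V] [InnerProductSpace ℂ V] [FiniteDimensional ℂ V]

/-- The inverse of the change of local spin frames acts smoothly on spinors. -/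
lemma SpinBundle.contDiffAt_rep_frameChange {B : SpinBundle n M} (γ : CliffordMatrices n V)
    (G G' : B.Gauge) {y : Euc n} (hy : y ∈ G'.chart.target)
    (hy' : G'.chart.symm y ∈ G.chart.source) :
    ContDiffAt ℝ ∞ (fun z => γ.rep ((B.frameChange (G.frame (G'.chart.symm z))
      (G'.frame (G'.chart.symm z)))⁻¹ : Spin n)) y := by
  set φ := G'.chart with hφ
  obtain ⟨f, hf, hx⟩ := B.cover (φ.symm y)
  obtain ⟨k, hk, hkf⟩ := G.smooth_frame f hf
  obtain ⟨k', hk', hkf'⟩ := G'.smooth_frame f hf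
  set U := G.chart.source ∩ f.1 with hU
  set U' := φ.source ∩ f.1 with hU'
  have : FiniteDimensional ℝ (V →L[ℂ] V) := FiniteDimensional.complexToReal _
  -- On the spin group, inversion is the restriction of this linear map. Smoothness of spin-valued
  -- maps is defined by linear functionals, so it passes to inverses.
  let S : Cliff n →ₗ[ℝ] Cliff n :=
    CliffordAlgebra.reverse ∘ₗ CliffordAlgebra.involute.toLinearMap
  have h1 := hk.contDiffOn_linear G'.chart_mem γ.rep.toLinearMap
  have h2 := hk'.contDiffOn_linear G'.chart_mem (γ.rep.toLinearMap ∘ₗ S)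
  have hO : ∀ W, IsOpen W → IsOpen (φ.target ∩ φ.symm ⁻¹' W) := fun W hW =>
    φ.isOpen_inter_preimage_symm hW
  have hoU := hO U (G.chart.open_source.inter (B.isOpen_of_mem f hf))
  have hoU' := hO U' (φ.open_source.inter (B.isOpen_of_mem f hf))
  have hyU : y ∈ φ.target ∩ φ.symm ⁻¹' U := ⟨hy, hy', hx⟩
  have hyU' : y ∈ φ.target ∩ φ.symm ⁻¹' U' := ⟨hy, φ.map_target hy, hx⟩
  have h1' := h1.contDiffAt (hoU.mem_nhds hyU)
  have h2' := h2.contDiffAt (hoU'.mem_nhds hyU')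
  -- With both frames written relative to the same atlas section, by `k` and `k'`, the inverse frame
  -- change is `k'⁻¹ k`.
  refine (h2'.mul h1').congr_of_eventuallyEq ?_
  filter_upwards [hoU.mem_nhds hyU, hoU'.mem_nhds hyU'] with z hz hz'
  rw [hkf _ hz.2, hkf' _ hz'.2, B.frameChange_act_act, mul_inv_rev, inv_inv, Submonoid.coe_mul,
    map_mul]
  rfl

end FrameChange

/-! ### Extension of local spinors to global twisted spinors -/

section Extension

variable {n : ℕ} {M : Type*} [TopologicalSpace M] [ChartedSpace (Euc n) M]

/-- The determinant of a family of `n` vectors in Euclidean `n`-space. -/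
noncomputable abbrev euclideanDet (n : ℕ) : (Euc n) [⋀^Fin n]→ₗ[ℝ] ℝ :=
  (EuclideanSpace.basisFun (Fin n) ℝ).toBasis.det

lemma contDiffAt_euclideanDet {E : Type*} [NormedAddCommGroup E] [NormedSpace ℝ E]
    {w : E → Fin n → Euc n} {y : E} (hw : ∀ j, ContDiffAt ℝ ∞ (fun z => w z j) y) :
    ContDiffAt ℝ ∞ (fun z => euclideanDet n (w z)) y := by
  simp only [euclideanDet, Module.Basis.det_apply, Matrix.det_apply', Module.Basis.toMatrix_apply]
  refine ContDiffAt.sum fun σ _ => contDiffAt_const.mul (contDiffAt_prod fun i _ => ?_)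
  simp only [OrthonormalBasis.coe_toBasis_repr_apply, EuclideanSpace.basisFun_repr]
  exact (contDiff_piLp_apply (𝕜 := ℝ) 2 (i := σ i)).contDiffAt.comp y (hw i)

/-- The value of `(dx¹ … dxⁿ)^{1/4}` on an `n`-tuple of tangent vectors. -/
noncomputable def coordQuarterDensity (φ : OpenPartialHomeomorph M (Euc n)) (x : M)
    (v : Fin n → TangentSpace 𝓘(ℝ, Euc n) x) : ℝ :=
  |euclideanDet n fun j => mfderiv 𝓘(ℝ, Euc n) 𝓘(ℝ, Euc n) φ x (v j)| ^ (1 / 4 : ℝ)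

lemma coordQuarterDensity_map (φ : OpenPartialHomeomorph M (Euc n)) (x : M)
    (v : Fin n → TangentSpace 𝓘(ℝ, Euc n) x)
    (A : TangentSpace 𝓘(ℝ, Euc n) x →ₗ[ℝ] TangentSpace 𝓘(ℝ, Euc n) x) :
    coordQuarterDensity φ x (fun μ => A (v μ))
      = |LinearMap.det A| ^ (1 / 4 : ℝ) * coordQuarterDensity φ x v := by
  set b := (EuclideanSpace.basisFun (Fin n) ℝ).toBasis
  let D : Euc n →ₗ[ℝ] Euc n := (mfderiv 𝓘(ℝ, Euc n) 𝓘(ℝ, Euc n) φ x).toLinearMap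
  let A' : Euc n →ₗ[ℝ] Euc n := A
  let v' : Fin n → Euc n := v
  have h1 : b.det (D ∘ v') = LinearMap.det D * b.det v' := b.det_comp D v'
  have h2 : b.det (D ∘ A' ∘ v') = LinearMap.det D * (LinearMap.det A' * b.det v') := by
    rw [b.det_comp, b.det_comp]
  change |b.det (D ∘ A' ∘ v')| ^ (1 / 4 : ℝ)
    = |LinearMap.det A'| ^ (1 / 4 : ℝ) * |b.det (D ∘ v')| ^ (1 / 4 : ℝ)
  rw [h1, h2, ← Real.mul_rpow (abs_nonneg _) (abs_nonneg _), ← abs_mul]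
  ring_nf

section

variable {φ φ' : OpenPartialHomeomorph M (Euc n)}

lemma contDiffAt_transition
    (hφ : φ ∈ IsManifold.maximalAtlas 𝓘(ℝ, Euc n) ∞ M)
    (hφ' : φ' ∈ IsManifold.maximalAtlas 𝓘(ℝ, Euc n) ∞ M)
    {y : Euc n} (hy : y ∈ φ'.target) (hy' : φ'.symm y ∈ φ.source) :
    ContDiffAt ℝ ∞ (fun z => φ (φ'.symm z)) y :=
  contMDiffAt_iff_contDiffAt.1 <| (contMDiffAt_of_mem_maximalAtlas hφ hy').comp y
    (contMDiffAt_symm_of_mem_maximalAtlas hφ' hy)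

lemma mfderiv_coordVector
    (hφ : φ ∈ IsManifold.maximalAtlas 𝓘(ℝ, Euc n) ∞ M)
    (hφ' : φ' ∈ IsManifold.maximalAtlas 𝓘(ℝ, Euc n) ∞ M)
    {y : Euc n} (hy : y ∈ φ'.target) (hy' : φ'.symm y ∈ φ.source)
    (μ : Fin n) :
    mfderiv 𝓘(ℝ, Euc n) 𝓘(ℝ, Euc n) φ (φ'.symm y) (coordVector φ' y μ)
      = fderiv ℝ (fun z => φ (φ'.symm z)) y (EuclideanSpace.single μ 1) := by
  have h := mfderiv_comp y
    ((contMDiffAt_of_mem_maximalAtlas hφ hy').mdifferentiableAt (by simp))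
    ((contMDiffAt_symm_of_mem_maximalAtlas hφ' hy).mdifferentiableAt (by simp))
  rw [← mfderiv_eq_fderiv]
  exact (DFunLike.congr_fun h _).symm

/-- The transition map and its inverse compose to the identity near the point, so by the chain rule
their Jacobian determinants have product `1`. -/
lemma det_transition_ne_zero
    (hφ : φ ∈ IsManifold.maximalAtlas 𝓘(ℝ, Euc n) ∞ M)
    (hφ' : φ' ∈ IsManifold.maximalAtlas 𝓘(ℝ, Euc n) ∞ M)
    {y : Euc n} (hy : y ∈ φ'.target) (hy' : φ'.symm y ∈ φ.source) :
    euclideanDet n (fun μ => fderiv ℝ (fun z => φ (φ'.symm z)) y (EuclideanSpace.single μ 1))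
      ≠ 0 := by
  set x := φ'.symm y
  have h1 := contDiffAt_transition hφ hφ' hy hy'
  have hx : φ.symm (φ x) = x := φ.left_inv hy'
  have h2 : ContDiffAt ℝ ∞ (fun z => φ' (φ.symm z)) (φ x) :=
    contDiffAt_transition hφ' hφ (φ.map_source hy') (by rw [hx]; exact φ'.map_target hy)
  have hd := (h2.differentiableAt (by simp)).hasFDerivAt.comp y
    (h1.differentiableAt (by simp)).hasFDerivAt
  have hid : HasFDerivAt (fun z : Euc n => z) (ContinuousLinearMap.id ℝ (Euc n)) y :=
    hasFDerivAt_id y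
  have hev : ((fun z => φ' (φ.symm z)) ∘ fun z => φ (φ'.symm z)) =ᶠ[𝓝 y] fun z => z := by
    filter_upwards [(φ'.isOpen_inter_preimage_symm φ.open_source).mem_nhds ⟨hy, hy'⟩] with z hz
    simp only [Function.comp_apply]
    rw [φ.left_inv hz.2, φ'.right_inv hz.1]
  have hcomp := (hd.congr_of_eventuallyEq hev.symm).unique hid
  set D := fderiv ℝ (fun z => φ (φ'.symm z)) y
  set b := (EuclideanSpace.basisFun (Fin n) ℝ).toBasis with hb
  have hdet : b.det (fun μ => D (EuclideanSpace.single μ 1)) = LinearMap.det D.toLinearMap := by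
    have := b.det_comp D.toLinearMap b
    rw [b.det_self, mul_one] at this
    rw [← this]
    congr 1
    funext μ
    simp [hb]
  rw [hdet]
  have hm := congrArg (fun L : Euc n →L[ℝ] Euc n => LinearMap.det L.toLinearMap) hcomp
  simp only [ContinuousLinearMap.toLinearMap_comp, LinearMap.det_comp] at hm
  rw [ContinuousLinearMap.coe_id, LinearMap.det_id] at hm
  exact right_ne_zero_of_mul_eq_one hm

/-- In the other chart this is `|det|^{1/4}` of the Jacobian of the transition map, and `|t|^{1/4}`
is smooth away from `t = 0`. -/
lemma contDiffAt_coordQuarterDensity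
    (hφ : φ ∈ IsManifold.maximalAtlas 𝓘(ℝ, Euc n) ∞ M)
    (hφ' : φ' ∈ IsManifold.maximalAtlas 𝓘(ℝ, Euc n) ∞ M)
    {y : Euc n} (hy : y ∈ φ'.target)
    (hy' : φ'.symm y ∈ φ.source) :
    ContDiffAt ℝ ∞ (fun z => coordQuarterDensity φ (φ'.symm z) (coordVector φ' z)) y := by
  have hev : (fun z => coordQuarterDensity φ (φ'.symm z) (coordVector φ' z)) =ᶠ[𝓝 y] fun z =>
      |euclideanDet n (fun μ => fderiv ℝ (fun z => φ (φ'.symm z)) z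
        (EuclideanSpace.single μ 1))| ^ (1 / 4 : ℝ) := by
    filter_upwards [(φ'.isOpen_inter_preimage_symm φ.open_source).mem_nhds ⟨hy, hy'⟩] with z hz
    simp only [coordQuarterDensity, mfderiv_coordVector hφ hφ' hz.1 hz.2]
  have hne := det_transition_ne_zero hφ hφ' hy hy'
  have h1 : ContDiffAt ℝ ∞ (fderiv ℝ (fun z => φ (φ'.symm z))) y :=
    (contDiffAt_transition hφ hφ' hy hy').fderiv_right (m := ∞) (by simp)
  have h2 : ContDiffAt ℝ ∞ (fun z => euclideanDet n fun μ =>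
      fderiv ℝ (fun z => φ (φ'.symm z)) z (EuclideanSpace.single μ 1)) y :=
    contDiffAt_euclideanDet fun μ => h1.clm_apply contDiffAt_const
  exact ((h2.abs hne).rpow_const_of_ne (abs_ne_zero.2 hne)).congr_of_eventuallyEq hev

end

lemma coordQuarterDensity_coordVector 
    {φ : OpenPartialHomeomorph M (Euc n)}
    (hφ : φ ∈ IsManifold.maximalAtlas 𝓘(ℝ, Euc n) ∞ M) {y : Euc n} (hy : y ∈ φ.target) :
    coordQuarterDensity φ (φ.symm y) (coordVector φ y) = 1 := by
  have hev : (fun z => φ (φ.symm z)) =ᶠ[𝓝 y] id := by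
    filter_upwards [φ.open_target.mem_nhds hy] with z hz using φ.right_inv hz
  simp only [coordQuarterDensity, mfderiv_coordVector hφ hφ hy (φ.map_target hy), hev.fderiv_eq,
    fderiv_id, ContinuousLinearMap.id_apply]
  have : (fun μ => EuclideanSpace.single μ (1 : ℝ))
      = (EuclideanSpace.basisFun (Fin n) ℝ).toBasis := by
    funext μ; simp
  rw [this, Module.Basis.det_self]
  simp

variable {V : Type*} [NormedAddCommGroup V] [InnerProductSpace ℂ V] [FiniteDimensional ℂ V]

open Classical in
/-- The twisted spinor with component `ψ` in one chart and local spin frame, extended by zero. -/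
noncomputable def gaugeExtension {B : SpinBundle n M} (γ : CliffordMatrices n V) (G : B.Gauge)
    (ψ : Euc n → V) (x : M) (p : B.Fib x) (v : Fin n → TangentSpace 𝓘(ℝ, Euc n) x) : V :=
  if x ∈ G.chart.source then coordQuarterDensity G.chart x v •
    γ.rep ((B.frameChange (G.frame x) p)⁻¹ : Spin n) (ψ (G.chart x))
  else 0

/-- Over the domain of `G` the component is a product of smooth factors: the Jacobian density, the
frame change and `ψ` in the new coordinates. Elsewhere it vanishes locally, since the support of `ψ`
has compact, hence closed, image in the Hausdorff space `M`. -/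
lemma gaugeExtension_contDiffOn [T2Space M] {B : SpinBundle n M}
    (γ : CliffordMatrices n V) (G G' : B.Gauge) {ψ : Euc n → V} (hψ : ContDiff ℝ ∞ ψ)
    (hc : HasCompactSupport ψ) (hsupp : tsupport ψ ⊆ G.chart.target) :
    ContDiffOn ℝ ∞ (fun y => gaugeExtension γ G ψ (G'.chart.symm y)
      (G'.frame (G'.chart.symm y)) (coordVector G'.chart y)) G'.chart.target := by
  intro y hy
  refine ContDiffAt.contDiffWithinAt ?_
  by_cases hx : G'.chart.symm y ∈ G.chart.source
  · have hev : (fun y => gaugeExtension γ G ψ (G'.chart.symm y)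
        (G'.frame (G'.chart.symm y)) (coordVector G'.chart y)) =ᶠ[𝓝 y] fun z =>
        coordQuarterDensity G.chart (G'.chart.symm z) (coordVector G'.chart z) •
        γ.rep ((B.frameChange (G.frame (G'.chart.symm z)) (G'.frame (G'.chart.symm z)))⁻¹ : Spin n)
          (ψ (G.chart (G'.chart.symm z))) := by
      filter_upwards [(G'.chart.isOpen_inter_preimage_symm G.chart.open_source).mem_nhds
        ⟨hy, hx⟩] with z hz
      exact if_pos hz.2
    refine ContDiffAt.congr_of_eventuallyEq ?_ hev
    refine (contDiffAt_coordQuarterDensity G.chart_mem G'.chart_mem hy hx).smul ?_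
    have h1 := (ContinuousLinearMap.restrictScalarsL ℂ V V ℝ ℝ).contDiff.contDiffAt.comp y
      (B.contDiffAt_rep_frameChange γ G G' hy hx)
    exact h1.clm_apply
      (hψ.contDiffAt.comp y (contDiffAt_transition G.chart_mem G'.chart_mem hy hx))
  · set C := G.chart.symm '' tsupport ψ with hC
    have hCc : IsClosed C :=
      (hc.isCompact.image_of_continuousOn (G.chart.continuousOn_symm.mono hsupp)).isClosed
    have hyC : G'.chart.symm y ∉ C := by
      rintro ⟨z, hz, hzy⟩
      exact hx (hzy ▸ G.chart.map_target (hsupp hz))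
    have hev : (fun y => gaugeExtension γ G ψ (G'.chart.symm y)
        (G'.frame (G'.chart.symm y)) (coordVector G'.chart y)) =ᶠ[𝓝 y] fun _ => 0 := by
      filter_upwards [(G'.chart.isOpen_inter_preimage_symm hCc.isOpen_compl).mem_nhds
        ⟨hy, hyC⟩] with z hz
      rw [gaugeExtension]
      split_ifs with h
      · rw [image_eq_zero_of_notMem_tsupport fun hz' => hz.2 ⟨_, hz', G.chart.left_inv h⟩,
          map_zero, smul_zero]
      · rfl
    exact contDiffAt_const.congr_of_eventuallyEq hev

/-- A compactly supported spinor in a chart extends to a global twisted spinor. -/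
noncomputable def TwistedSpinor.ofGauge [T2Space M]
    {P : SpinStructure n M} (γ : CliffordMatrices n V) (G : P.Gauge) {ψ : Euc n → V}
    (hψ : ContDiff ℝ ∞ ψ) (hc : HasCompactSupport ψ) (hsupp : tsupport ψ ⊆ G.chart.target) :
    TwistedSpinor P γ where
  toFun := gaugeExtension γ G ψ
  equivariant x p k v := by
    unfold gaugeExtension
    split_ifs
    -- Acting by `k` on the frame puts `k⁻¹` in front of the inverse frame change, where `γ.rep k`
    -- cancels it.
    · rw [P.frameChange_act, ContinuousLinearMap.map_smul_of_tower, mul_inv_rev, ← mul_apply_eq_comp,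
        ← map_mul, ← Submonoid.coe_mul, mul_inv_cancel_left]
    · exact map_zero _
  density x p v A := by
    unfold gaugeExtension
    split_ifs
    · rw [coordQuarterDensity_map, mul_smul]
    · rw [smul_zero]
  smooth G' := gaugeExtension_contDiffOn γ G G' hψ hc hsupp

lemma TwistedSpinor.comp_ofGauge [T2Space M]
    {P : SpinStructure n M} (γ : CliffordMatrices n V) (G : P.Gauge) {ψ : Euc n → V}
    (hψ : ContDiff ℝ ∞ ψ) (hc : HasCompactSupport ψ) (hsupp : tsupport ψ ⊆ G.chart.target)
    {y : Euc n} (hy : y ∈ G.chart.target) :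
    (TwistedSpinor.ofGauge γ G hψ hc hsupp).comp G y = ψ y := by
  change gaugeExtension γ G ψ _ _ _ = _
  rw [gaugeExtension, if_pos (G.chart.map_target hy), G.chart.right_inv hy,
    coordQuarterDensity_coordVector G.chart_mem hy, P.frameChange_self, inv_one, one_smul]
  simp

end Extension

/-! ### The two implications -/

section Main

/-- The cutoff is `1` near each point of `K`, not just on `K`, so that multiplying by it does not
change first derivatives there. -/
lemma exists_smooth_cutoff {E : Type*} [NormedAddCommGroup E] [NormedSpace ℝ E]
    [FiniteDimensional ℝ E] {K Ω : Set E} (hK : IsCompact K) (hΩ : IsOpen Ω) (hKΩ : K ⊆ Ω) :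
    ∃ χ : E → ℝ, ContDiff ℝ ∞ χ ∧ HasCompactSupport χ ∧ tsupport χ ⊆ Ω ∧
      ∀ y ∈ K, ∀ᶠ z in 𝓝 y, χ z = 1 := by
  obtain ⟨L, hL, hKL, hLΩ⟩ := exists_compact_between hK hΩ hKΩ
  obtain ⟨χ, h1, h0, -⟩ := exists_contMDiffMap_one_nhds_of_subset_interior 𝓘(ℝ, E) (n := ⊤)
    hK.isClosed hKL
  have hsub : tsupport χ ⊆ L := closure_minimal
    (fun y hy => by_contra fun h => hy (h0 y h)) hL.isClosed
  exact ⟨χ, χ.contMDiff.contDiff, hL.of_isClosed_subset (isClosed_tsupport _) hsub,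
    hsub.trans hLΩ, fun y hy => h1.filter_mono (nhds_le_nhdsSet hy)⟩

lemma MemLp.smul_continuousOn {X E : Type*} [TopologicalSpace X] [MeasurableSpace X]
    [OpensMeasurableSpace X] [NormedAddCommGroup E] [NormedSpace ℝ E] [T2Space X] {ν : Measure X}
    {K : Set X} (hK : IsCompact K) {F : X → E} (hF : MemLp F 2 (ν.restrict K)) {h : X → ℝ}
    (hh : ContinuousOn h K) : MemLp (fun y => h y • F y) 2 (ν.restrict K) := by
  obtain ⟨C, hC⟩ := hK.exists_bound_of_continuousOn hh
  have hhm := (hh.aemeasurable (μ := ν) hK.measurableSet).aestronglyMeasurable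
  refine hF.of_le_mul (c := C) (hhm.smul hF.1) ?_
  filter_upwards [ae_restrict_mem hK.measurableSet] with y hy
  rw [norm_smul]
  gcongr
  exact hC y hy

variable {n : ℕ} {M : Type*} [TopologicalSpace M] [ChartedSpace (Euc n) M]
  {P : SpinStructure n M} {g : SingularMetric P}
  {V : Type*} [NormedAddCommGroup V]

namespace SingularMetric

/-- Choose a dissection that has `K` as a piece: the integral over `K` is one summand of a finite
sum. -/
lemma MemL2.memLp_restrict [IsManifold 𝓘(ℝ, Euc n) ∞ M] [T2Space M] [CompactSpace M]
    {Ξ : P.Gauge → Euc n → V} (h : g.MemL2 Ξ) (G : P.Gauge) {K : Set (Euc n)}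
    (hK : IsCompact K) (hKG : K ⊆ G.chart.target) :
    MemLp (Ξ G) 2 ((g.densityMeasure G (1 / 4)).restrict K) := by
  obtain ⟨D, k, hG, hKD⟩ := P.exists_dissection G hK hKG
  refine ⟨(h.1 G).restrict, ?_⟩
  have hk := ENNReal.sum_lt_top.1 (h.2 D) k (Finset.mem_univ k)
  rw [hKD, hG] at hk
  rw [eLpNorm_lt_top_iff_lintegral_rpow_enorm_lt_top (by simp) (by simp)]
  simpa using hk

/-- Each piece of a dissection lies in a compact subset of a chart, and there are finitely many
pieces. -/
lemma memL2_of_memLp_restrict {Ξ : P.Gauge → Euc n → V}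
    (hm : ∀ G, AEStronglyMeasurable (Ξ G) (g.densityMeasure G (1 / 4)))
    (h : ∀ G : P.Gauge, ∀ K ⊆ G.chart.target, IsCompact K →
      MemLp (Ξ G) 2 ((g.densityMeasure G (1 / 4)).restrict K)) : g.MemL2 Ξ := by
  refine ⟨hm, fun D => ENNReal.sum_lt_top.2 fun k _ => ?_⟩
  obtain ⟨K, hK, hpK, hKs⟩ := D.relCompact k
  have hK' := hK.image_of_continuousOn ((D.gauge k).chart.continuousOn.mono hKs)
  have hsub : (D.gauge k).chart '' K ⊆ (D.gauge k).chart.target := by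
    rintro _ ⟨x, hx, rfl⟩
    exact (D.gauge k).chart.map_source (hKs hx)
  have hfin := (h (D.gauge k) _ hsub hK').2
  rw [eLpNorm_lt_top_iff_lintegral_rpow_enorm_lt_top (by simp) (by simp)] at hfin
  refine lt_of_le_of_lt (lintegral_mono_set (Set.image_mono hpK)) ?_
  simpa using hfin

variable [InnerProductSpace ℂ V] [FiniteDimensional ℂ V] {γ : CliffordMatrices n V}

/-- If the Dirac operator maps smooth sections to square integrable ones, then the local formula
gives square integrable functions for every smooth function on a chart. -/
lemma memLp_dirac_of_forall_memL2 [IsManifold 𝓘(ℝ, Euc n) ∞ M] [T2Space M] [CompactSpace M]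
    (h : ∀ Ψ : TwistedSpinor P γ, g.MemL2 (g.diracHat γ Ψ)) (G : P.Gauge) {K : Set (Euc n)}
    (hK : IsCompact K) (hKG : K ⊆ G.chart.target) {f : Euc n → V} (hf : ContDiff ℝ ∞ f) :
    MemLp (fun y => ∑ i, ∑ μ, g.dualFrame G i μ y •
      γ.mat i (fderiv ℝ f y (EuclideanSpace.single μ 1)) + g.potential G γ y (f y)) 2
      ((g.densityMeasure G (1 / 4)).restrict K) := by
  obtain ⟨χ, hχ, hχc, hχs, hχ1⟩ := exists_smooth_cutoff hK G.chart.open_target hKG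
  have hψ : ContDiff ℝ ∞ fun y => χ y • f y := hχ.smul hf
  have hψc : HasCompactSupport fun y => χ y • f y := hχc.smul_right
  have hψs : tsupport (fun y => χ y • f y) ⊆ G.chart.target :=
    (tsupport_smul_subset_left χ f).trans hχs
  -- The factor `√-1` cancels the factor `-√-1` of the Dirac operator.
  have hL := ((h (TwistedSpinor.ofGauge γ G hψ hψc hψs)).memLp_restrict G hK hKG).const_smul
    Complex.I
  refine hL.ae_eq ?_
  filter_upwards [ae_restrict_mem hK.measurableSet] with y hy
  have hev : (TwistedSpinor.ofGauge γ G hψ hψc hψs).comp G =ᶠ[𝓝 y] f := by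
    filter_upwards [G.chart.open_target.mem_nhds (hKG hy), hχ1 y hy] with z hz hz1
    rw [TwistedSpinor.comp_ofGauge γ G hψ hψc hψs hz, hz1, one_smul]
  rw [Pi.smul_apply, diracHat_eq, hev.fderiv_eq, hev.eq_of_nhds, smul_neg, smul_smul,
    Complex.I_mul_I, neg_one_smul, neg_neg]

/-- On constant spinors the first order part vanishes. -/
lemma pointwiseL2_potential [IsManifold 𝓘(ℝ, Euc n) ∞ M] [T2Space M] [CompactSpace M]
    (h : ∀ Ψ : TwistedSpinor P γ, g.MemL2 (g.diracHat γ Ψ)) (G : P.Gauge) {K : Set (Euc n)}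
    (hK : IsCompact K) (hKG : K ⊆ G.chart.target) :
    PointwiseL2 ((g.densityMeasure G (1 / 4)).restrict K) (g.potential G γ) := fun v => by
  simpa using memLp_dirac_of_forall_memL2 h G hK hKG (contDiff_const (c := v))

/-- Test on `y^μ v`: the derivative picks out `e_i^μ γ^i v`, and the remainder `y^μ Z v` is square
integrable because `y^μ` is bounded on `K`. The anticommutator with `γ^a` then isolates `2 e_a^μ`.
-/
lemma memLp_dualFrame [IsManifold 𝓘(ℝ, Euc n) ∞ M] [T2Space M] [CompactSpace M] [Nontrivial V]
    (h : ∀ Ψ : TwistedSpinor P γ, g.MemL2 (g.diracHat γ Ψ)) (G : P.Gauge) {K : Set (Euc n)}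
    (hK : IsCompact K) (hKG : K ⊆ G.chart.target) (a μ : Fin n) :
    MemLp (g.dualFrame G a μ) 2 ((g.densityMeasure G (1 / 4)).restrict K) := by
  have hS : PointwiseL2 ((g.densityMeasure G (1 / 4)).restrict K)
      fun y => ∑ i, g.dualFrame G i μ y • γ.mat i := fun v => by
    let L : Euc n →L[ℝ] V := (EuclideanSpace.proj μ : Euc n →L[ℝ] ℝ).smulRight v
    have h1 := memLp_dirac_of_forall_memL2 h G hK hKG L.contDiff
    have h2 := MemLp.smul_continuousOn hK (pointwiseL2_potential h G hK hKG v)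
      (h := fun y => y μ) (by fun_prop)
    refine (h1.sub h2).ae_eq (Filter.Eventually.of_forall fun y => ?_)
    have hLy : L y = y μ • v := rfl
    have hLe : ∀ ν, L (EuclideanSpace.single ν 1) = if μ = ν then v else 0 := fun ν => by
      have : L (EuclideanSpace.single ν 1) = (EuclideanSpace.single ν (1 : ℝ) : Euc n) μ • v := rfl
      rw [this, PiLp.single_apply]
      split_ifs <;> simp
    simp only [Pi.sub_apply, ContinuousLinearMap.fderiv, hLe, hLy,
      ContinuousLinearMap.map_smul_of_tower, add_sub_cancel_right, sum_apply, smul_apply]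
    refine Finset.sum_congr rfl fun i _ => ?_
    rw [Finset.sum_eq_single μ (fun ν _ hν => by simp [hν.symm]) (by simp), if_pos rfl]
  have h2 := ((hS.const_mul (γ.mat a)).add (hS.mul_const (γ.mat a)))
  simp only [anticomm_vector γ.anticomm] at h2
  have h3 := (PointwiseL2.memLp_of_smul_one h2).const_mul (1 / 2)
  refine h3.ae_eq (Filter.Eventually.of_forall fun y => ?_)
  ring

lemma memLp_altOmega [IsManifold 𝓘(ℝ, Euc n) ∞ M] [T2Space M] [CompactSpace M] [Nontrivial V]
    (h : ∀ Ψ : TwistedSpinor P γ, g.MemL2 (g.diracHat γ Ψ)) (G : P.Gauge) {K : Set (Euc n)}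
    (hK : IsCompact K) (hKG : K ⊆ G.chart.target) (a b c : Fin n) :
    MemLp (g.altOmega G a b c) 2 ((g.densityMeasure G (1 / 4)).restrict K) := by
  have hS := pointwiseL2_potential h G hK hKG
  have h1 := (hS.const_mul (γ.mat a)).add (hS.mul_const (γ.mat a))
  have h2 := (h1.const_mul (γ.mat b)).sub (h1.mul_const (γ.mat b))
  have h3 := (h2.const_mul (γ.mat c)).add (h2.mul_const (γ.mat c))
  have key := fun y => iterated_comm_eq γ.anticomm (T := fun i j k => g.altOmega G i j k y)
    (fun i j k => alt_swap_left _ i j k) (fun i j k => alt_swap_right _ i j k)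
    (fun b => g.traceTerm G b y) (Z := g.potential G γ y) rfl a b c rfl
  simp only [key] at h3
  have h4 := (PointwiseL2.memLp_of_smul_one h3).const_mul (1 / 12)
  refine h4.ae_eq (Filter.Eventually.of_forall fun y => ?_)
  ring

/-- Once the antisymmetric coefficients are known to be square integrable, the cubic part can be
subtracted from the potential. An anticommutator then reads off the vector part, as `¼ t_a`. -/
lemma memLp_traceTerm [IsManifold 𝓘(ℝ, Euc n) ∞ M] [T2Space M] [CompactSpace M] [Nontrivial V]
    (h : ∀ Ψ : TwistedSpinor P γ, g.MemL2 (g.diracHat γ Ψ)) (G : P.Gauge) {K : Set (Euc n)}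
    (hK : IsCompact K) (hKG : K ⊆ G.chart.target) (a : Fin n) :
    MemLp (g.traceTerm G a) 2 ((g.densityMeasure G (1 / 4)).restrict K) := by
  have hT : PointwiseL2 ((g.densityMeasure G (1 / 4)).restrict K) fun y => (1 / 4 : ℝ) •
      ∑ i, ∑ j, ∑ k, g.altOmega G i j k y • (γ.mat i * γ.mat j * γ.mat k) :=
    .const_smul (.sum _ fun i _ => .sum _ fun j _ => .sum _ fun k _ =>
      .of_memLp (memLp_altOmega h G hK hKG i j k) _) _
  have hS := (pointwiseL2_potential h G hK hKG).sub hT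
  simp only [potential, add_sub_cancel_left] at hS
  have h2 := ((hS.const_mul (γ.mat a)).add (hS.mul_const (γ.mat a)))
  simp only [mul_smul_comm, smul_mul_assoc, ← smul_add, anticomm_vector γ.anticomm,
    smul_smul] at h2
  have h3 := (PointwiseL2.memLp_of_smul_one h2).const_mul 4
  refine h3.ae_eq (Filter.Eventually.of_forall fun y => ?_)
  ring

lemma aestronglyMeasurable_of_continuousOn_smul {G : P.Gauge} {f : Euc n → ℝ} {h : Euc n → V}
    (hf : AEMeasurable f (g.densityMeasure G (1 / 4))) (hh : ContinuousOn h G.chart.target) :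
    AEStronglyMeasurable (fun y => f y • h y) (g.densityMeasure G (1 / 4)) := by
  have : FiniteDimensional ℝ V := FiniteDimensional.complexToReal V
  have : ProperSpace V := FiniteDimensional.proper ℝ V
  borelize V
  exact hf.aestronglyMeasurable.smul <|
    (hh.aemeasurable G.chart.open_target.measurableSet).aestronglyMeasurable.mono_ac
      (g.densityMeasure_absolutelyContinuous G _)

/-- A property of functions on a chart that is closed under sums holds for the components of
`D̂ Ψ` if it holds for all products of the coefficients with continuous functions. -/
lemma diracHat_induction (G : P.Gauge) (Ψ : TwistedSpinor P γ) (p : (Euc n → V) → Prop)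
    (hsum : ∀ (s : Finset (Fin n)) (F : Fin n → Euc n → V), (∀ i ∈ s, p (F i)) →
      p fun y => ∑ i ∈ s, F i y)
    (hadd : ∀ F F', p F → p F' → p fun y => F y + F' y)
    (hsmul : ∀ (c : ℂ) F, p F → p fun y => c • F y)
    (h1 : ∀ a μ (f : Euc n → V), ContinuousOn f G.chart.target →
      p fun y => g.dualFrame G a μ y • f y)
    (h2 : ∀ a b c (f : Euc n → V), ContinuousOn f G.chart.target →
      p fun y => g.altOmega G a b c y • f y)
    (h3 : ∀ b (f : Euc n → V), ContinuousOn f G.chart.target →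
      p fun y => g.traceTerm G b y • f y) :
    p (g.diracHat γ Ψ G) := by
  have hΨ : ContDiffOn ℝ ∞ (Ψ.comp G) G.chart.target := Ψ.smooth G
  have hdΨ : ContinuousOn (fderiv ℝ (Ψ.comp G)) G.chart.target :=
    hΨ.continuousOn_fderiv_of_isOpen G.chart.open_target (by simp)
  have hcl : ∀ (A : V →L[ℂ] V) {f : Euc n → V}, ContinuousOn f G.chart.target →
      ContinuousOn (fun y => A (f y)) G.chart.target := fun A f hf =>
    A.continuous.comp_continuousOn hf
  -- The real constants are written as complex ones so that `hsmul` covers every constant factor.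
  have heq : g.diracHat γ Ψ G = fun y => (-Complex.I) • (∑ i, ∑ μ, g.dualFrame G i μ y •
      γ.mat i (fderiv ℝ (Ψ.comp G) y (EuclideanSpace.single μ 1))
        + (((1 / 4 : ℝ) : ℂ) • ∑ i, ∑ j, ∑ k, g.altOmega G i j k y •
            (γ.mat i * γ.mat j * γ.mat k) (Ψ.comp G y)
          + ((1 / 8 : ℝ) : ℂ) • ∑ b, g.traceTerm G b y • γ.mat b (Ψ.comp G y))) := by
    funext y
    rw [diracHat_eq, neg_smul]
    simp only [potential, add_apply, smul_apply, sum_apply, Complex.coe_smul]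
  rw [heq]
  refine hsmul _ _ <| hadd _ _ (hsum _ _ fun i _ => hsum _ _ fun μ _ => h1 _ _ _ ?_) <|
    hadd _ _
      (hsmul _ _ <| hsum _ _ fun i _ => hsum _ _ fun j _ => hsum _ _ fun k _ => h2 _ _ _ _ ?_)
      (hsmul _ _ <| hsum _ _ fun b _ => h3 _ _ ?_)
  · exact hcl _ (hdΨ.clm_apply continuousOn_const)
  · exact hcl _ hΨ.continuousOn
  · exact hcl _ hΨ.continuousOn

/-- `MemL2` asks for measurability on the whole chart, while the integrability hypotheses concern
its compact subsets. It is obtained here from the measurability of the frame and of its weak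
derivatives. -/
lemma aestronglyMeasurable_diracHat (Ψ : TwistedSpinor P γ) (G : P.Gauge) :
    AEStronglyMeasurable (g.diracHat γ Ψ G) (g.densityMeasure G (1 / 4)) := by
  have hoF : ∀ a b c, AEMeasurable (g.omegaFrame G a b c) (g.densityMeasure G (1 / 4)) :=
    fun a b c => Finset.aemeasurable_fun_sum _ fun μ _ =>
      (g.aemeasurable_omega G _ a b μ).mul (g.aemeasurable_dualFrame G _ c μ)
  refine diracHat_induction G Ψ (AEStronglyMeasurable · (g.densityMeasure G (1 / 4)))
    (fun s F hF => Finset.aestronglyMeasurable_fun_sum s hF) (fun F F' hF hF' => hF.add hF')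
    (fun c F hF => hF.const_smul c)
    (fun a μ f hf => aestronglyMeasurable_of_continuousOn_smul (g.aemeasurable_dualFrame G _ a μ) hf)
    (fun a b c f hf => aestronglyMeasurable_of_continuousOn_smul ?_ hf)
    (fun b f hf => aestronglyMeasurable_of_continuousOn_smul ?_ hf)
  · exact ((((((hoF a b c).add (hoF b c a)).add (hoF c a b)).sub (hoF b a c)).sub
      (hoF a c b)).sub (hoF c b a)).div_const 6
  · exact (aemeasurable_const.mul <| Finset.aemeasurable_fun_sum _ fun a _ =>
      Finset.aemeasurable_fun_sum _ fun μ _ => (g.aemeasurable_dualFrame G _ a μ).mul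
        (g.aemeasurable_omega G _ a b μ)).sub <| Finset.aemeasurable_fun_sum _ fun μ _ =>
      (g.aemeasurable_dualFrame G _ b μ).mul (g.aemeasurable_dLog G _ μ)

lemma memLp_diracHat (Ψ : TwistedSpinor P γ) (G : P.Gauge) {K : Set (Euc n)}
    (hK : IsCompact K) (hKG : K ⊆ G.chart.target)
    (h1 : ∀ a μ, g.LocL2 G (g.dualFrame G a μ)) (h2 : ∀ a b c, g.LocL2 G (g.altOmega G a b c))
    (h3 : ∀ b, g.LocL2 G (g.traceTerm G b)) :
    MemLp (g.diracHat γ Ψ G) 2 ((g.densityMeasure G (1 / 4)).restrict K) := by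
  have : FiniteDimensional ℝ V := FiniteDimensional.complexToReal V
  have : ProperSpace V := FiniteDimensional.proper ℝ V
  exact diracHat_induction G Ψ (MemLp · 2 ((g.densityMeasure G (1 / 4)).restrict K))
    (fun s F hF => memLp_finsetSum s hF) (fun F F' hF hF' => hF.add hF')
    (fun c F hF => hF.const_smul c)
    (fun a μ f hf => MemLp.continuousOn_smul hK (h1 a μ K hKG hK) (hf.mono hKG))
    (fun a b c f hf => MemLp.continuousOn_smul hK (h2 a b c K hKG hK) (hf.mono hKG))
    (fun b f hf => MemLp.continuousOn_smul hK (h3 b K hKG hK) (hf.mono hKG))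

end SingularMetric

end Main

end QuarterDensityDirac

theorem proposition9 {n : ℕ} {M : Type*} [TopologicalSpace M]
    [ChartedSpace (QuarterDensityDirac.Euc n) M]
    [IsManifold 𝓘(ℝ, QuarterDensityDirac.Euc n) ∞ M] [T2Space M] [CompactSpace M]
    {V : Type*} [NormedAddCommGroup V] [InnerProductSpace ℂ V] [FiniteDimensional ℂ V]
    [Nontrivial V] (γ : QuarterDensityDirac.CliffordMatrices n V)
    (P : QuarterDensityDirac.SpinStructure n M)
    (g : QuarterDensityDirac.SingularMetric P) (hg : g.FiniteVolume) :
    (∀ Ψ : QuarterDensityDirac.TwistedSpinor P γ, g.MemL2 (g.diracHat γ Ψ)) ↔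
    ∀ G : P.Gauge,
      (∀ a μ, g.LocL2 G (g.dualFrame G a μ)) ∧
      (∀ a b c, g.LocL2 G
        (fun y => QuarterDensityDirac.alt (fun i j k => g.omegaFrame G i j k y) a b c)) ∧
      (∀ b, g.LocL2 G (fun y =>
        4 * ∑ a, ∑ μ, g.dualFrame G a μ y * g.omega G a b μ y
          - ∑ μ, g.dualFrame G b μ y * g.dLog G μ y)) := by
  refine ⟨fun h G => ⟨fun a μ K hK hKc => ?_, fun a b c K hK hKc => ?_, fun b K hK hKc => ?_⟩,
    fun h Ψ => ?_⟩
  · exact QuarterDensityDirac.SingularMetric.memLp_dualFrame h G hKc hK a μ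
  · exact QuarterDensityDirac.SingularMetric.memLp_altOmega h G hKc hK a b c
  · exact QuarterDensityDirac.SingularMetric.memLp_traceTerm h G hKc hK b
  · exact QuarterDensityDirac.SingularMetric.memL2_of_memLp_restrict
      (QuarterDensityDirac.SingularMetric.aestronglyMeasurable_diracHat Ψ)
      fun G K hK hKc => QuarterDensityDirac.SingularMetric.memLp_diracHat Ψ G hKc hK
        (h G).1 (h G).2.1 (h G).2.2
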